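/- There are a single algorithm and constants $C, c$ such that the following holds. Let $G$ be a graph on $n$ vertices, let $k \ge 0$ and $r \ge 2$ be integers, and let a nice tree decomposition of $G$ with $N$ nodes and of width $\mathrm{tw}$ be given. On input the graph, the rooted decomposition, $k$ and $r$, the algorithm computes the number of partitions of $V(G)$ into $k$ cliques of size $r$ and $\frac{n-rk}{r-1}$ cliques of size $r-1$ (this number is $0$ if $\frac{n-rk}{r-1}$ is not a non-negative integer) in time $O^*(2^{\mathrm{tw}})$, that is, in time at most $C\cdot 2^{\mathrm{tw}}\cdot(n+N+|k|+|r|)^{c}$, where $|x|$ is the binary length of $x$ and time is measured on a random access machine with logarithmic cost (the graph, the rooted tree and the bags are given as $0$-$1$ matrices). Here a tree decomposition of $G$ is a tree $T$ with bags $B_x \subseteq V(G)$, $x \in V(T)$, such that the bags cover $V(G)$, every edge of $G$ lies inside some bag, and $B_i \cap B_j \subseteq B_q$ whenever $q$ is on the path from $i$ to $j$ in $T$; its width is the size of a largest bag minus one (taken to be $0$ if all bags are empty). It is nice if $T$ is rooted at a node with empty bag and each node $x$ is a leaf with $B_x=\emptyset$; or has exactly one child $y$, and $B_x\setminus B_y=\{u\}$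 for some $u$ (introduce node); or has exactly one child $y$, and $B_y\setminus B_x=\{u\}$ for some $u$ (forget node); or has exactly two children $y,z$, and $B_x=B_y=B_z$ (join node). -/

import Mathlib

namespace CliquePartition

/-! ### Random access machines with logarithmic cost

Programs are structured (assignments, sequencing, branching, loops). A program refers to finitely
many scalar registers and finitely many arrays by fixed names; array cells hold arbitrary natural
numbers and are addressed indirectly, by computed indices. Every value and every address that is
handled is charged its length in binary. -/

/-- The contents of the machine: scalar registers and arrays of natural numbers. -/
structure State where
  var : ℕ → ℕ
  arr : ℕ → ℕ → ℕ

/-- The arithmetic operations and comparisons of the machine. -/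
inductive BinOp where
  | add | sub | mul | div | mod | eq | lt

/-- The value of an operation; `sub` is truncated, `x / 0 = 0`, `x % 0 = x`, and the comparisons
return `1` or `0`. -/
def BinOp.apply : BinOp → ℕ → ℕ → ℕ
  | .add, x, y => x + y
  | .sub, x, y => x - y
  | .mul, x, y => x * y
  | .div, x, y => x / y
  | .mod, x, y => x % y
  | .eq, x, y => if x = y then 1 else 0
  | .lt, x, y => if x < y then 1 else 0

/-- Expressions: constants, registers, array cells, operations. -/
inductive Expr where
  | const (c : ℕ)
  | var (x : ℕ)
  | read (a : ℕ) (i : Expr)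
  | bin (o : BinOp) (e₁ e₂ : Expr)

/-- The value of an expression. -/
def Expr.eval (s : State) : Expr → ℕ
  | .const c => c
  | .var x => s.var x
  | .read a i => s.arr a (i.eval s)
  | .bin o e₁ e₂ => o.apply (e₁.eval s) (e₂.eval s)

/-- The logarithmic cost of evaluating an expression: the value of each subexpression (so each
operand, each address, each cell that is read) is charged one more than its length in binary. -/
def Expr.cost (s : State) : Expr → ℕ
  | .const c => Nat.size c + 1
  | .var x => Nat.size (s.var x) + 1
  | .read a i => i.cost s + Nat.size (s.arr a (i.eval s)) + 1
  | .bin o e₁ e₂ => e₁.cost s + e₂.cost s + Nat.size (o.apply (e₁.eval s) (e₂.eval s)) + 1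

/-- Programs. -/
inductive Program where
  | skip
  | assign (x : ℕ) (e : Expr)
  | write (a : ℕ) (i e : Expr)
  | seq (p q : Program)
  | ite (e : Expr) (p q : Program)
  | loop (e : Expr) (p : Program)

/-- The state after `x := v`. -/
def State.setVar (s : State) (x v : ℕ) : State :=
  { s with var := Function.update s.var x v }

/-- The state after `a[i] := v`. -/
def State.setArr (s : State) (a i v : ℕ) : State :=
  { s with arr := Function.update s.arr a (Function.update (s.arr a) i v) }

/-- `Exec p s s' t`: started in `s`, the program `p` halts in the state `s'` after time `t`.
`loop e p` repeats `p` as long as `e` is nonzero. -/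
inductive Exec : Program → State → State → ℕ → Prop
  | skip (s : State) : Exec .skip s s 1
  | assign (x : ℕ) (e : Expr) (s : State) :
      Exec (.assign x e) s (s.setVar x (e.eval s)) (e.cost s + 1)
  | write (a : ℕ) (i e : Expr) (s : State) :
      Exec (.write a i e) s (s.setArr a (i.eval s) (e.eval s)) (i.cost s + e.cost s + 1)
  | seq {p q : Program} {s s₁ s₂ : State} {t₁ t₂ : ℕ} :
      Exec p s s₁ t₁ → Exec q s₁ s₂ t₂ → Exec (.seq p q) s s₂ (t₁ + t₂ + 1)
  | ite_true {e : Expr} {p q : Program} {s s' : State} {t : ℕ} :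
      e.eval s ≠ 0 → Exec p s s' t → Exec (.ite e p q) s s' (e.cost s + t + 1)
  | ite_false {e : Expr} {p q : Program} {s s' : State} {t : ℕ} :
      e.eval s = 0 → Exec q s s' t → Exec (.ite e p q) s s' (e.cost s + t + 1)
  | loop_stop {e : Expr} {p : Program} {s : State} :
      e.eval s = 0 → Exec (.loop e p) s s (e.cost s + 1)
  | loop_step {e : Expr} {p : Program} {s s₁ s₂ : State} {t₁ t₂ : ℕ} :
      e.eval s ≠ 0 → Exec p s s₁ t₁ → Exec (.loop e p) s₁ s₂ t₂ →
      Exec (.loop e p) s s₂ (e.cost s + t₁ + t₂ + 1)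

/-- The machine is deterministic: the final state and the running time are unique. -/
theorem Exec.deterministic {p : Program} {s s₁ s₂ : State} {t₁ t₂ : ℕ}
    (h₁ : Exec p s s₁ t₁) (h₂ : Exec p s s₂ t₂) : s₁ = s₂ ∧ t₁ = t₂ := by
  induction h₁ generalizing s₂ t₂ with
  | skip | assign | write => cases h₂; exact ⟨rfl, rfl⟩
  | seq _ _ ih ih' =>
    cases h₂ with
    | seq a b => obtain ⟨rfl, rfl⟩ := ih a; obtain ⟨rfl, rfl⟩ := ih' b; exact ⟨rfl, rfl⟩
  | ite_true h _ ih =>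
    cases h₂ with
    | ite_true _ a => obtain ⟨rfl, rfl⟩ := ih a; exact ⟨rfl, rfl⟩
    | ite_false h' _ => exact absurd h' h
  | ite_false h _ ih =>
    cases h₂ with
    | ite_true h' _ => exact absurd h h'
    | ite_false _ a => obtain ⟨rfl, rfl⟩ := ih a; exact ⟨rfl, rfl⟩
  | loop_stop h =>
    cases h₂ with
    | loop_stop _ => exact ⟨rfl, rfl⟩
    | loop_step h' _ _ => exact absurd h h'
  | loop_step h _ _ ih ih' =>
    cases h₂ with
    | loop_stop h' => exact absurd h' h
    | loop_step _ a b => obtain ⟨rfl, rfl⟩ := ih a; obtain ⟨rfl, rfl⟩ := ih' b; exact ⟨rfl, rfl⟩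

/-! ### Nice tree decompositions -/

/-- A tree decomposition of `G` whose tree has the vertex set `ι`. -/
structure TreeDecomposition {V : Type*} (G : SimpleGraph V) (ι : Type*) where
  tree : SimpleGraph ι
  isTree : tree.IsTree
  bag : ι → Finset V
  exists_mem_bag : ∀ v : V, ∃ x, v ∈ bag x
  exists_edge_bag : ∀ u v : V, G.Adj u v → ∃ x, u ∈ bag x ∧ v ∈ bag x
  bag_path : ∀ (i j q : ι) (p : tree.Walk i j), p.IsPath → q ∈ p.support →
    ∀ v, v ∈ bag i → v ∈ bag j → v ∈ bag q

namespace TreeDecomposition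

variable {V ι : Type*} {G : SimpleGraph V}

/-- The size of a largest bag minus one (`0` if all bags are empty). -/
def width [Fintype ι] (D : TreeDecomposition G ι) : ℕ :=
  (Finset.univ.sup fun x => (D.bag x).card) - 1

/-- `y` is a child of `x` when the tree is rooted at `root`. -/
def IsChild (D : TreeDecomposition G ι) (root x y : ι) : Prop :=
  D.tree.Adj x y ∧ D.tree.dist root y = D.tree.dist root x + 1

/-- `x` is a leaf with an empty bag. -/
def IsLeafNode (D : TreeDecomposition G ι) (root x : ι) : Prop :=
  (∀ y, ¬ D.IsChild root x y) ∧ D.bag x = ∅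

/-- `x` has exactly one child `y`, and exactly one vertex of `B_x` is not in `B_y`. -/
def IsIntroduceNode [DecidableEq V] (D : TreeDecomposition G ι) (root x : ι) : Prop :=
  ∃ y, (∀ z, D.IsChild root x z ↔ z = y) ∧ ∃ u, D.bag x \ D.bag y = {u}

/-- `x` has exactly one child `y`, and exactly one vertex of `B_y` is not in `B_x`. -/
def IsForgetNode [DecidableEq V] (D : TreeDecomposition G ι) (root x : ι) : Prop :=
  ∃ y, (∀ z, D.IsChild root x z ↔ z = y) ∧ ∃ u, D.bag y \ D.bag x = {u}

/-- `x` has exactly two children, and all three bags are equal. -/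
def IsJoinNode (D : TreeDecomposition G ι) (root x : ι) : Prop :=
  ∃ y z, y ≠ z ∧ (∀ w, D.IsChild root x w ↔ w = y ∨ w = z) ∧
    D.bag x = D.bag y ∧ D.bag x = D.bag z

/-- The tree decomposition, rooted at `root`, is nice. -/
def IsNice [DecidableEq V] (D : TreeDecomposition G ι) (root : ι) : Prop :=
  D.bag root = ∅ ∧
    ∀ x, D.IsLeafNode root x ∨ D.IsIntroduceNode root x ∨ D.IsForgetNode root x ∨
      D.IsJoinNode root x

end TreeDecomposition

/-! ### The counting problem and its input -/

/-- The number of partitions of the vertex set of `G` into cliques, `k` of them of size `r` and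
`(n - r k) / (r - 1)` (a rational number) of them of size `r - 1`, and none of any other size. -/
noncomputable def cliquePartitionCount {n : ℕ} (G : SimpleGraph (Fin n)) (k r : ℕ) : ℕ :=
  Nat.card {P : Finpartition (Finset.univ : Finset (Fin n)) //
    (∀ A ∈ P.parts, G.IsClique (A : Set (Fin n)) ∧ (A.card = r ∨ A.card = r - 1)) ∧
    (P.parts.filter fun A => A.card = r).card = k ∧
    ((P.parts.filter fun A => A.card = r - 1).card : ℚ) =
      ((n : ℚ) - (r : ℚ) * (k : ℚ)) / ((r : ℚ) - 1)}

open Classical in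
/-- The array that stores the 0-1 matrix of a relation row by row (and `0` beyond it). -/
noncomputable def matrixArray {a b : ℕ} (R : Fin a → Fin b → Prop) (i : ℕ) : ℕ :=
  if ∃ (u : Fin a) (v : Fin b), i = (u : ℕ) * b + (v : ℕ) ∧ R u v then 1 else 0

/-- The initial contents of the machine. Registers `0, …, 4`: the number of vertices, the number
of nodes of the tree, `k`, `r`, the root. Arrays `0, 1, 2`: the adjacency matrix of the graph, the
parent-child matrix of the rooted tree, the node-vertex incidence matrix of the bags. Everything
else is `0`. -/
noncomputable def inputState {n N : ℕ} {G : SimpleGraph (Fin n)}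
    (D : TreeDecomposition G (Fin N)) (root : Fin N) (k r : ℕ) : State where
  var
    | 0 => n
    | 1 => N
    | 2 => k
    | 3 => r
    | 4 => (root : ℕ)
    | _ => 0
  arr
    | 0 => matrixArray G.Adj
    | 1 => matrixArray (D.IsChild root)
    | 2 => matrixArray fun x v => v ∈ D.bag x
    | _ => fun _ => 0

end CliquePartition

namespace CliquePartition

/-! ### Total correctness with time bounds -/

/-! Give a clique C the term b^|C| z if |C| = r and b^|C| if |C| = r - 1, and every other set the
term 0; call it a(C). Inclusion-exclusion over the set X of vertices that may be used turns a sum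
over covers into a sum over subsets: the sum of (-1)^|V \ X| ∏_{C ⊆ X} (1 + a(C)) over all X equals
the sum of ∏_{C ∈ F} a(C) over all families F with union V (`sum_prod_powerset_eq_sum_cover`). A
cover has total size at least n, with equality exactly for partitions. So the lowest coefficient,
that of b^n, is the polynomial ∑ p_i z^i, where p_i counts the partitions with i cliques of size r
(`sum_cover_cliqueTerm`). Disjointness is read off from the exponent of b and never has to be
stored.

The signed sum over X is computed by eliminating vertices along the tree (`sum_eq_root`). A factor 1
+ a(C) differs from 1 only if C is a clique, and any two vertices of a clique share a bag. Hence,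
when a deepest remaining node y with parent x is removed, the vertices of B_y \ B_x interact only
with B_y, and summing them out leaves a function on the subsets of B_x ∩ B_y. A table is indexed by
the subsets of one bag, and the messages of several children are multiplied pointwise. Since no
subset convolution occurs, the exponential factor is 2^(tw+1), not 3^tw or 4^tw. Products over all
subsets of a set and the signed sums are computed one vertex at a time (`prodLayer_succ`,
`sumLayer_succ`).

Instead of polynomials the machine handles numbers: z is a power of two above every p_i, b is a
power of two above ∑ p_i z^i, and everything is taken modulo b^(n+1). These numbers have
polynomially many bits. Reducing modulo b^(n+1) and dividing by b^n leaves a number whose base-z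
digits are the p_i (`Triple.extract`).

For the machine, `Triple` is a total-correctness statement that counts steps. A step costs at most a
constant times the bit bound B, so running time is the number of steps times a polynomial. -/

@[simp]
theorem State.setVar_var (s : State) (x v y : ℕ) :
    (s.setVar x v).var y = if y = x then v else s.var y := by
  simp [State.setVar, Function.update_apply]

@[simp]
theorem State.setVar_arr (s : State) (x v : ℕ) : (s.setVar x v).arr = s.arr := rfl

@[simp]
theorem State.setArr_var (s : State) (a i v : ℕ) : (s.setArr a i v).var = s.var := rfl

@[simp]
theorem State.setArr_arr (s : State) (a i v b : ℕ) :
    (s.setArr a i v).arr b = if b = a then Function.update (s.arr a) i v else s.arr b := by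
  simp only [State.setArr, Function.update_apply]

/-- All registers and all cells hold numbers of at most `B` bits. -/
def Bounded (B : ℕ) (s : State) : Prop :=
  (∀ x, s.var x < 2 ^ B) ∧ ∀ a i, s.arr a i < 2 ^ B

/-- The registers outside `vs` and the arrays outside `as` agree. -/
def Frame (vs as : List ℕ) (s s' : State) : Prop :=
  (∀ x, x ∉ vs → s'.var x = s.var x) ∧ ∀ a, a ∉ as → s'.arr a = s.arr a

theorem Frame.refl (vs as : List ℕ) (s : State) : Frame vs as s s :=
  ⟨fun _ _ => rfl, fun _ _ => rfl⟩

theorem Frame.mono {vs as vs' as' : List ℕ} {s s' : State} (h : Frame vs as s s')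
    (hv : vs ⊆ vs') (ha : as ⊆ as') : Frame vs' as' s s' :=
  ⟨fun x hx => h.1 x fun h' => hx (hv h'), fun a hx => h.2 a fun h' => hx (ha h')⟩

theorem Frame.trans {vs as : List ℕ} {s s' s'' : State} (h : Frame vs as s s')
    (h' : Frame vs as s' s'') : Frame vs as s s'' :=
  ⟨fun x hx => (h'.1 x hx).trans (h.1 x hx), fun a ha => (h'.2 a ha).trans (h.2 a ha)⟩

/-- The length of the value of an expression is at most this many times that of a cell. -/
def Expr.sizeWeight : Expr → ℕ
  | .const c => Nat.size c
  | .var _ => 1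
  | .read _ _ => 1
  | .bin _ e₁ e₂ => e₁.sizeWeight + e₂.sizeWeight + 1

/-- The cost of an expression is at most this many times the length of a cell. -/
def Expr.weight : Expr → ℕ
  | .const c => Nat.size c + 1
  | .var _ => 1
  | .read _ i => i.weight + 1
  | .bin o e₁ e₂ => e₁.weight + e₂.weight + (Expr.bin o e₁ e₂).sizeWeight + 1

theorem BinOp.size_apply_le (o : BinOp) (x y : ℕ) :
    Nat.size (o.apply x y) ≤ Nat.size x + Nat.size y + 1 := by
  have hx := Nat.lt_size_self x
  have hy := Nat.lt_size_self y
  rw [Nat.size_le]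
  have hxy : 2 ^ (Nat.size x + Nat.size y + 1) = 2 * (2 ^ Nat.size x * 2 ^ Nat.size y) := by ring
  have h1 : 1 ≤ 2 ^ Nat.size x := Nat.one_le_two_pow
  have h2 : 1 ≤ 2 ^ Nat.size y := Nat.one_le_two_pow
  have h3 : x < 2 ^ (Nat.size x + Nat.size y + 1) := by rw [hxy]; nlinarith
  cases o with
  | add => simp only [apply]; rw [hxy]; nlinarith
  | sub => exact (Nat.sub_le x y).trans_lt h3
  | mul => simp only [apply]; rw [hxy]; nlinarith [Nat.mul_le_mul hx.le hy.le]
  | div => exact (Nat.div_le_self x y).trans_lt h3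
  | mod => exact (Nat.mod_le x y).trans_lt h3
  | eq => simp only [apply]; rw [hxy]; split <;> nlinarith
  | lt => simp only [apply]; rw [hxy]; split <;> nlinarith

/-- Only stored values are kept below 2^B. Addresses and intermediate results may be larger, but
each operation at most adds the lengths of its operands plus one, so a factor that depends only on
the syntax suffices and addresses need no range analysis. -/
theorem Expr.size_eval_le {B : ℕ} {s : State} (hs : Bounded B s) (e : Expr) :
    Nat.size (e.eval s) ≤ e.sizeWeight * (B + 1) := by
  induction e with
  | const c => simp only [eval, sizeWeight]; nlinarith
  | var x => simp only [eval, sizeWeight]; have := Nat.size_le.2 (hs.1 x); omega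
  | read a i _ =>
    simp only [eval, sizeWeight]; have := Nat.size_le.2 (hs.2 a (i.eval s)); omega
  | bin o e₁ e₂ h₁ h₂ =>
    simp only [eval, sizeWeight]
    have := o.size_apply_le (e₁.eval s) (e₂.eval s)
    nlinarith

theorem Expr.cost_le {B : ℕ} {s : State} (hs : Bounded B s) (e : Expr) :
    e.cost s ≤ e.weight * (B + 1) := by
  induction e with
  | const c => simp only [cost, weight]; nlinarith
  | var x => simp only [cost, weight]; have := Nat.size_le.2 (hs.1 x); omega
  | read a i h =>
    simp only [cost, weight]; have := Nat.size_le.2 (hs.2 a (i.eval s)); nlinarith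
  | bin o e₁ e₂ h₁ h₂ =>
    have := Expr.size_eval_le hs (.bin o e₁ e₂)
    simp only [cost, weight]
    simp only [eval] at this
    nlinarith

/-- A bound on the cost of a single step of the program, relative to the length of a cell. -/
def Program.weight : Program → ℕ
  | .skip => 1
  | .assign _ e => e.weight + 1
  | .write _ i e => i.weight + e.weight + 1
  | .seq p q => p.weight + q.weight + 1
  | .ite e p q => e.weight + p.weight + q.weight + 1
  | .loop e p => e.weight + p.weight + 1

/-- The registers a program assigns. -/
def Program.vars : Program → List ℕ
  | .skip => []
  | .assign x _ => [x]
  | .write _ _ _ => []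
  | .seq p q => p.vars ++ q.vars
  | .ite _ p q => p.vars ++ q.vars
  | .loop _ p => p.vars

/-- The arrays a program writes to. -/
def Program.arrs : Program → List ℕ
  | .skip => []
  | .assign _ _ => []
  | .write a _ _ => [a]
  | .seq p q => p.arrs ++ q.arrs
  | .ite _ p q => p.arrs ++ q.arrs
  | .loop _ p => p.arrs

/-- Started in `s`, if `s` is bounded, the program `p` halts within `T` steps in a bounded state
that satisfies `Q`, and it changes only the registers and arrays that it mentions. A step costs at
most `W * (B + 1)`. -/
def Triple (W B : ℕ) (p : Program) (s : State) (T : ℕ) (Q : State → Prop) : Prop :=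
  Bounded B s → p.weight ≤ W → ∃ s' t, Exec p s s' t ∧ t ≤ W * (B + 1) * T ∧ Bounded B s' ∧
    Frame p.vars p.arrs s s' ∧ Q s'

variable {W B : ℕ}

theorem Triple.mono {p : Program} {s : State} {T T' : ℕ} {Q Q' : State → Prop}
    (h : Triple W B p s T Q) (hT : T ≤ T')
    (hQ : ∀ s', Frame p.vars p.arrs s s' → Q s' → Q' s') : Triple W B p s T' Q' := by
  intro hs hp
  obtain ⟨s', t, h1, h2, h3, h4, h5⟩ := h hs hp
  exact ⟨s', t, h1, h2.trans (Nat.mul_le_mul_left _ hT), h3, h4, hQ s' h4 h5⟩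

/-- Makes the bound on the cells available in a proof about a value that is merely copied. -/
theorem Triple.of_bounded {p : Program} {s : State} {T : ℕ} {Q : State → Prop}
    (h : Bounded B s → Triple W B p s T Q) : Triple W B p s T Q :=
  fun hs => h hs hs

theorem Triple.assign {x : ℕ} {e : Expr} {s : State} {Q : State → Prop}
    (hv : e.eval s < 2 ^ B) (hQ : Q (s.setVar x (e.eval s))) :
    Triple W B (.assign x e) s 1 Q := by
  intro hs hp
  refine ⟨_, _, Exec.assign x e s, ?_, ⟨fun y => ?_, hs.2⟩, ⟨fun y hy => ?_, fun _ _ => rfl⟩, hQ⟩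
  · have := Expr.cost_le hs e
    simp only [Program.weight] at hp
    nlinarith
  · rw [State.setVar_var]; split
    · exact hv
    · exact hs.1 y
  · rw [State.setVar_var, if_neg (by simpa [Program.vars] using hy)]

theorem Triple.write {a : ℕ} {i e : Expr} {s : State} {Q : State → Prop}
    (hv : e.eval s < 2 ^ B) (hQ : Q (s.setArr a (i.eval s) (e.eval s))) :
    Triple W B (.write a i e) s 1 Q := by
  intro hs hp
  refine ⟨_, _, Exec.write a i e s, ?_, ⟨hs.1, fun b j => ?_⟩, ⟨fun _ _ => rfl, fun b hb => ?_⟩,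
    hQ⟩
  · have := Expr.cost_le hs e
    have := Expr.cost_le hs i
    simp only [Program.weight] at hp
    nlinarith
  · rw [State.setArr_arr]; split
    · rw [Function.update_apply]; split
      · exact hv
      · exact hs.2 _ j
    · exact hs.2 b j
  · rw [State.setArr_arr, if_neg (by simpa [Program.arrs] using hb)]

theorem Triple.seq {p q : Program} {s : State} {T₁ T₂ : ℕ} {Q₁ Q : State → Prop}
    (h₁ : Triple W B p s T₁ Q₁)
    (h₂ : ∀ s₁, Frame p.vars p.arrs s s₁ → Q₁ s₁ → Triple W B q s₁ T₂ Q) :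
    Triple W B (.seq p q) s (T₁ + T₂ + 1) Q := by
  intro hs hp
  simp only [Program.weight] at hp
  obtain ⟨s₁, t₁, a1, a2, a3, a4, a5⟩ := h₁ hs (by omega)
  obtain ⟨s₂, t₂, b1, b2, b3, b4, b5⟩ := h₂ s₁ a4 a5 a3 (by omega)
  refine ⟨s₂, _, a1.seq b1, ?_, b3, ?_, b5⟩
  · have : 1 ≤ W * (B + 1) := Nat.mul_pos (by omega) (by omega)
    nlinarith
  · exact (a4.mono (List.subset_append_left _ _) (List.subset_append_left _ _)).trans
      (b4.mono (List.subset_append_right _ _) (List.subset_append_right _ _))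

theorem Triple.assign_seq {x : ℕ} {e : Expr} {q : Program} {s : State} {T : ℕ}
    {Q : State → Prop} (hv : e.eval s < 2 ^ B)
    (h : Triple W B q (s.setVar x (e.eval s)) T Q) :
    Triple W B (.seq (.assign x e) q) s (T + 2) Q := by
  have := Triple.seq (Triple.assign (W := W) (B := B) (Q := (· = s.setVar x (e.eval s))) hv rfl)
    (fun s₁ _ h₁ => h₁ ▸ h)
  exact this.mono (by omega) fun _ _ h => h

theorem Triple.write_seq {a : ℕ} {i e : Expr} {q : Program} {s : State} {T : ℕ}
    {Q : State → Prop} (hv : e.eval s < 2 ^ B)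
    (h : Triple W B q (s.setArr a (i.eval s) (e.eval s)) T Q) :
    Triple W B (.seq (.write a i e) q) s (T + 2) Q := by
  have := Triple.seq (Triple.write (W := W) (B := B)
    (Q := (· = s.setArr a (i.eval s) (e.eval s))) hv rfl) (fun s₁ _ h₁ => h₁ ▸ h)
  exact this.mono (by omega) fun _ _ h => h

/-- `for x < l do p`, where `l` is a register. -/
def forTo (x l : ℕ) (p : Program) : Program :=
  .seq (.assign x (.const 0))
    (.loop (.bin .lt (.var x) (.var l)) (.seq p (.assign x (.bin .add (.var x) (.const 1)))))

/-- The 4 extra steps per round pay for the test, the increment and the two constant charges of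
sequencing and looping; the final 3 pay for the initialisation and the last, failing test. The frame
in `hstep` refers to the state before the loop, so invariants need not repeat what the body leaves
alone. -/
theorem Triple.forLoop {x l : ℕ} {p : Program} {s₀ : State} {T : ℕ} (I : ℕ → State → Prop)
    (hl : l ∉ x :: p.vars) (hx : x ∉ p.vars) (h0 : I 0 (s₀.setVar x 0))
    (hstep : ∀ i s, i < s₀.var l → s.var x = i → Frame (x :: p.vars) p.arrs s₀ s → I i s →
      Triple W B p s T fun s' => I (i + 1) (s'.setVar x (i + 1))) :
    Triple W B (forTo x l p) s₀ (s₀.var l * (T + 4) + 3)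
      (I (s₀.var l)) := by
  -- Induction on the number j of rounds that remain.
  have key : ∀ j i s, i + j = s₀.var l → s.var x = i → Frame (x :: p.vars) p.arrs s₀ s → I i s →
      Triple W B (.loop (.bin .lt (.var x) (.var l))
        (.seq p (.assign x (.bin .add (.var x) (.const 1))))) s (j * (T + 4) + 1)
        (I (s₀.var l)) := by
    intro j
    induction j with
    | zero =>
      intro i s hij hi hF hI hs hp
      have hl' := hF.1 l hl
      refine ⟨s, _, Exec.loop_stop (if_neg (by simp only [Expr.eval]; omega)), ?_, hs,
        Frame.refl _ _ _, by rwa [← hij, Nat.add_zero]⟩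
      have := Expr.cost_le hs (.bin .lt (.var x) (.var l))
      simp only [Program.weight] at hp
      nlinarith
    | succ j ih =>
      intro i s hij hi hF hI hs hp
      have hl' := hF.1 l hl
      simp only [Program.weight] at hp
      obtain ⟨s₁, t₁, a1, a2, a3, a4, a5⟩ := hstep i s (by omega) hi hF hI hs (by omega)
      have hx1 : s₁.var x = i := by rw [a4.1 x hx, hi]
      have hlB : s₀.var l < 2 ^ B := by rw [← hl']; exact hs.1 l
      obtain ⟨s₂, t₂, b1, b2, b3, b4, b5⟩ := (Triple.assign (W := W) (B := B) (x := x)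
        (e := .bin .add (.var x) (.const 1)) (s := s₁) (Q := I (i + 1) ⊓ (·.var x = i + 1))
        (by simp [Expr.eval, BinOp.apply]; omega)
        (by constructor <;> simp [Expr.eval, BinOp.apply, hx1, a5, State.setVar_var]))
        a3 (by simp only [Program.weight]; omega)
      have hF2 : Frame (x :: p.vars) p.arrs s s₂ :=
        (a4.mono (List.subset_cons_self _ _) (List.Subset.refl _)).trans
          (b4.mono (by simp [Program.vars]) (by simp [Program.arrs]))
      obtain ⟨s₃, t₃, c1, c2, c3, c4, c5⟩ := ih (i + 1) s₂ (by omega) b5.2 (hF.trans hF2) b5.1 b3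
        (by simp only [Program.weight]; omega)
      refine ⟨s₃, _, Exec.loop_step (ne_of_eq_of_ne (if_pos (by simp only [Expr.eval]; omega)) one_ne_zero) (a1.seq b1) c1, ?_,
        c3, ?_, c5⟩
      · have h1 := Expr.cost_le hs (.bin .lt (.var x) (.var l))
        have h2 : (Expr.bin .lt (.var x) (.var l)).cost s ≤ W * (B + 1) :=
          h1.trans (Nat.mul_le_mul_right _ (by omega))
        have h3 : 1 ≤ W * (B + 1) := Nat.mul_pos (by omega) (by omega)
        nlinarith
      · refine Frame.trans (hF2.mono ?_ ?_) c4 <;> simp [Program.vars, Program.arrs]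
  refine (Triple.assign_seq (by simp [Expr.eval]) (key (s₀.var l) 0 _ (by omega)
    (by simp [Expr.eval, State.setVar_var]) ?_ (by simpa [Expr.eval] using h0))).mono (by omega)
    fun _ _ h => h
  refine ⟨fun y hy => ?_, fun _ _ => rfl⟩
  rw [State.setVar_var, if_neg fun h => hy (by simp [h])]

end CliquePartition

namespace CliquePartition

/-! ### Rooted trees -/

namespace TreeDecomposition

variable {V ι : Type*} {G : SimpleGraph V} (D : TreeDecomposition G ι) (root : ι)

theorem exists_isChild {y : ι} (hy : y ≠ root) : ∃ x, D.IsChild root x y := by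
  obtain ⟨p, hp⟩ := D.isTree.connected.exists_walk_length_eq_dist y root
  cases p with
  | nil => exact absurd rfl hy
  | @cons _ x _ h p =>
    refine ⟨x, h.symm, ?_⟩
    rw [SimpleGraph.Walk.length_cons] at hp
    have h1 : D.tree.dist x root ≤ p.length := SimpleGraph.dist_le p
    have h2 := D.isTree.dist_eq_dist_add_one_of_adj root h
    rw [D.tree.dist_comm (u := y)] at hp
    rw [D.tree.dist_comm] at h1
    omega

variable {D root}

/-- A shortest walk to a parent, extended by the edge to y, is again shortest and so is the unique
path from the root to y; the parent is its penultimate vertex. -/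
theorem IsChild.parent_unique {x x' y : ι} (h : D.IsChild root x y) (h' : D.IsChild root x' y) :
    x = x' := by
  have key : ∀ {w}, D.IsChild root w y → ∃ p : D.tree.Walk root y, p.IsPath ∧
      p.penultimate = w := by
    intro w hw
    obtain ⟨p, hp⟩ := D.isTree.connected.exists_walk_length_eq_dist root w
    refine ⟨p.concat hw.1, ?_, SimpleGraph.Walk.penultimate_concat _ _⟩
    apply SimpleGraph.Walk.isPath_of_length_eq_dist
    rw [SimpleGraph.Walk.length_concat, hp, hw.2]
  obtain ⟨p, hp, rfl⟩ := key h
  obtain ⟨p', hp', rfl⟩ := key h'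
  rw [(D.isTree.existsUnique_path root y).unique hp hp']

/-- A path that does not start towards the parent can only descend: an ascending edge would lead to
the unique parent, which the path avoids. -/
theorem IsChild.dist_lt {x y z : ι} (h : D.IsChild root x y) (p : D.tree.Walk y z)
    (hp : p.IsPath) (hx : x ∉ p.support) : D.tree.dist root x < D.tree.dist root z := by
  induction p generalizing x with
  | nil => have := h.2; omega
  | @cons y w z hadj p ih =>
    rw [SimpleGraph.Walk.cons_isPath_iff] at hp
    rcases D.isTree.dist_eq_dist_add_one_of_adj root hadj with h1 | h1
    · have := h.parent_unique ⟨hadj.symm, h1⟩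
      subst this
      simp at hx
    · have := ih ⟨hadj, h1⟩ hp.1 hp.2
      have := h.2
      omega

/-- The path from y to a node that is no deeper must begin with the edge to the parent x, since
otherwise it descends forever. The path condition on bags then applies at x. -/
theorem IsChild.bag_inter_subset {x y q : ι} (h : D.IsChild root x y) (hq : q ≠ y)
    (hd : D.tree.dist root q ≤ D.tree.dist root y) {v : V} (hy : v ∈ D.bag y)
    (hv : v ∈ D.bag q) : v ∈ D.bag x := by
  obtain ⟨p, hp, -⟩ := D.isTree.existsUnique_path y q
  refine D.bag_path y q x p hp ?_ v hy hv
  cases p with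
  | nil => exact absurd rfl hq
  | @cons _ w _ hadj p =>
    rw [SimpleGraph.Walk.cons_isPath_iff] at hp
    rcases D.isTree.dist_eq_dist_add_one_of_adj root hadj with h1 | h1
    · have := h.parent_unique ⟨hadj.symm, h1⟩
      subst this
      simp
    · have := IsChild.dist_lt (root := root) ⟨hadj, h1⟩ p hp.1 hp.2
      omega

theorem dist_lt_card [Fintype ι] (D : TreeDecomposition G ι) (x y : ι) :
    D.tree.dist x y < Fintype.card ι := by
  obtain ⟨p, hp, h⟩ := D.isTree.connected.exists_path_of_dist x y
  rw [← h]
  exact hp.length_lt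

end TreeDecomposition

/-! ### Elimination of the vertices along the tree -/

section Elimination

open Finset

theorem sum_powerset_union {V M : Type*} [DecidableEq V] [AddCommMonoid M] {A F : Finset V}
    (h : Disjoint A F) (f : Finset V → M) :
    ∑ X ∈ (A ∪ F).powerset, f X = ∑ X ∈ A.powerset, ∑ U ∈ F.powerset, f (X ∪ U) := by
  rw [← sum_product']
  symm
  refine sum_bij' (fun p _ => p.1 ∪ p.2) (fun X _ => (X ∩ A, X ∩ F)) ?_ ?_ ?_ ?_ ?_
  · rintro ⟨X, U⟩ hp
    simp only [mem_product, mem_powerset] at hp ⊢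
    exact union_subset_union hp.1 hp.2
  · intro X _
    simp only [mem_product, mem_powerset]
    exact ⟨inter_subset_right, inter_subset_right⟩
  · rintro ⟨X, U⟩ hp
    simp only [mem_product, mem_powerset] at hp
    rw [disjoint_left] at h
    ext v
    · simp only [mem_inter, mem_union]; have := @hp.1 v; have := @hp.2 v; have := @h v; tauto
    · simp only [mem_inter, mem_union]; have := @hp.1 v; have := @hp.2 v; have := @h v; tauto
  · intro X hX
    rw [mem_powerset] at hX
    rw [← inter_union_distrib_left, inter_eq_left.2 hX]
  · exact fun _ _ => rfl

theorem card_union_sdiff_union {V : Type*} [DecidableEq V] {A F X U : Finset V}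
    (h : Disjoint A F) (hX : X ⊆ A) (hU : U ⊆ F) :
    ((A ∪ F) \ (X ∪ U)).card = (A \ X).card + (F \ U).card := by
  rw [← card_union_of_disjoint (h.mono sdiff_subset sdiff_subset)]
  congr 1
  ext v
  have h1 := @hX v
  have h2 := @hU v
  have h3 : v ∈ A → v ∉ F := fun hv => disjoint_left.1 h hv
  simp only [mem_sdiff, mem_union]
  tauto

variable {V ι R : Type*} [DecidableEq V] [CommRing R]

/-- What a node with bag `By`, whose parent has the bag `Bx`, reports about `S ⊆ Bx ∩ By`, if
`f` is its table: the vertices of `By \ Bx` and the sets that contain one of them are summed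
out. -/
def message (w : Finset V → R) (Bx By : Finset V) (f : Finset V → R) (S : Finset V) : R :=
  ∑ U ∈ (By \ Bx).powerset, (-1) ^ ((By \ Bx) \ U).card *
    ((∏ C ∈ (S ∪ U).powerset, if C ⊆ Bx then 1 else w C) * f (S ∪ U))

-- Nodes are removed one by one, a deepest first. For a parent-closed set A of remaining nodes, the
-- sum runs over the subsets X of the union of their bags, with all weights and with the messages of
-- removed nodes whose parent is in A. Removing y leaves its value unchanged: the vertices in `bag
-- y` but not in the bag of its parent occur in no other remaining bag and are summed out. A set
-- inside the parent's bag gets the factor 1 in `message` because its weight stays in the outer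
-- product; this way every weight is counted once. All nodes give the original sum, and the root
-- alone, with its empty bag, gives `g root ∅`.
open Classical in
set_option maxHeartbeats 1000000 in
theorem sum_eq_root [Fintype V] [Fintype ι] (bag : ι → Finset V) (child : ι → ι → Prop)
    (depth : ι → ℕ) (root : ι) (w : Finset V → R) (g : ι → Finset V → R)
    (exists_parent : ∀ y, y ≠ root → ∃ x, child x y)
    (parent_unique : ∀ x x' y, child x y → child x' y → x = x')
    (depth_child : ∀ x y, child x y → depth y = depth x + 1)
    (bag_inter : ∀ x y q, child x y → q ≠ y → depth q ≤ depth y → ∀ v, v ∈ bag y → v ∈ bag q →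
      v ∈ bag x)
    (bag_root : bag root = ∅) (bag_cover : ∀ v, ∃ x, v ∈ bag x)
    (w_empty : w ∅ = 1)
    (w_pair : ∀ C, w C ≠ 1 → ∀ u ∈ C, ∀ v ∈ C, ∃ q, u ∈ bag q ∧ v ∈ bag q)
    (hg : ∀ x S, g x S = ∏ y, if child x y then message w (bag x) (bag y) (g y) (S ∩ bag y)
      else 1) :
    ∑ X : Finset V, (-1) ^ (univ \ X).card * ∏ C ∈ X.powerset, w C = g root ∅ := by
  have main : ∀ (k : ℕ) (A : Finset ι), A.card = k → root ∈ A →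
      (∀ x y, child x y → y ∈ A → x ∈ A) →
      (∀ C, w C ≠ 1 → ∀ u ∈ C, ∀ v ∈ C, u ∈ A.biUnion bag → v ∈ A.biUnion bag →
        ∃ q ∈ A, u ∈ bag q ∧ v ∈ bag q) →
      ∑ X ∈ (A.biUnion bag).powerset, (-1) ^ (A.biUnion bag \ X).card *
        ((∏ C ∈ X.powerset, w C) * ∏ q ∈ A, ∏ y, if y ∉ A ∧ child q y then
          message w (bag q) (bag y) (g y) (X ∩ bag q ∩ bag y) else 1) = g root ∅ := by
    intro k
    induction k with
    | zero =>
      intro A hA hr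
      rw [card_eq_zero.1 hA] at hr
      simp at hr
    | succ k ih =>
      intro A hA hr hup hpair
      by_cases hk : A = {root}
      · subst hk
        have hc : ∀ y, child root y → y ≠ root := by
          rintro y hy rfl
          have := depth_child _ _ hy
          omega
        simp only [singleton_biUnion, bag_root, powerset_empty, sum_singleton, prod_singleton,
          w_empty, sdiff_self, bot_eq_empty, card_empty, pow_zero, one_mul, hg root ∅, empty_inter]
        refine prod_congr rfl fun y _ => ?_
        by_cases hy : child root y
        · simp [hy, hc y hy]
        · simp [hy]
      · obtain ⟨y, hyA, hymax⟩ := exists_max_image A depth ⟨root, hr⟩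
        have hyr : y ≠ root := by
          rintro rfl
          refine hk (eq_singleton_iff_unique_mem.2 ⟨hr, fun z hz => ?_⟩)
          by_contra hzr
          obtain ⟨x, hx⟩ := exists_parent z hzr
          have := depth_child _ _ hx
          have hyz := hymax z hz
          -- Every node other than the root is strictly deeper than the root, so a deepest node of A
          -- is the root only if A is the root alone.
          have : ∀ d z, depth z = d → z ≠ y → depth y < depth z := by
            intro d
            induction d with
            | zero =>
              intro z hd hz
              obtain ⟨x, hx⟩ := exists_parent z hz
              have := depth_child _ _ hx
              omega
            | succ d ihd =>
              intro z hd hz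
              obtain ⟨x, hx⟩ := exists_parent z hz
              have h1 := depth_child _ _ hx
              by_cases hxy : x = y
              · subst hxy; omega
              · have := ihd x (by omega) hxy
                omega
          have := this _ z rfl hzr
          omega
        obtain ⟨x, hxy⟩ := exists_parent y hyr
        have hxA : x ∈ A := hup x y hxy hyA
        have hne : x ≠ y := by
          rintro rfl
          have := depth_child _ _ hxy
          omega
        set A' := A.erase y with hA'
        have hmem : ∀ {q}, q ∈ A' ↔ q ≠ y ∧ q ∈ A := by simp [hA']
        have hxA' : x ∈ A' := hmem.2 ⟨hne, hxA⟩
        have hint : ∀ q ∈ A', ∀ v, v ∈ bag y → v ∈ bag q → v ∈ bag x := fun q hq v =>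
          bag_inter x y q hxy (hmem.1 hq).1 (hymax q (hmem.1 hq).2) v
        set V' := A'.biUnion bag with hV'
        set F := bag y \ bag x with hF
        have hV'y : ∀ v, v ∈ V' → v ∈ bag y → v ∈ bag x := by
          intro v hv hvy
          obtain ⟨q, hq, hvq⟩ := mem_biUnion.1 hv
          exact hint q hq v hvy hvq
        have hdisj : Disjoint V' F := by
          rw [disjoint_left]
          intro v hv hvF
          rw [hF, mem_sdiff] at hvF
          exact hvF.2 (hV'y v hv hvF.1)
        have hVF : A.biUnion bag = V' ∪ F := by
          ext v
          simp only [mem_union, mem_biUnion, hV', hF, mem_sdiff]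
          constructor
          · rintro ⟨q, hq, hv⟩
            by_cases hqy : q = y
            · subst hqy
              by_cases hvx : v ∈ bag x
              · exact Or.inl ⟨x, hxA', hvx⟩
              · exact Or.inr ⟨hv, hvx⟩
            · exact Or.inl ⟨q, hmem.2 ⟨hqy, hq⟩, hv⟩
          · rintro (⟨q, hq, hv⟩ | hv)
            · exact ⟨q, (hmem.1 hq).2, hv⟩
            · exact ⟨y, hyA, hv.1⟩
        have ih' := ih A' (by rw [hA', card_erase_of_mem hyA, hA]; rfl)
          (hmem.2 ⟨hyr.symm, hr⟩)
          (fun a b hab hb => by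
            rw [hmem] at hb ⊢
            refine ⟨?_, hup a b hab hb.2⟩
            rintro rfl
            have := depth_child _ _ hab
            have := hymax b hb.2
            omega)
          -- If the common bag was that of y, the parent x replaces it: both vertices occur in other
          -- remaining bags and hence in `bag x`.
          (fun C hC u hu v hv huA hvA => by
            have hsub : ∀ {v}, v ∈ A'.biUnion bag → v ∈ A.biUnion bag := by
              intro v hv
              rw [hVF]
              exact mem_union_left _ hv
            obtain ⟨q, hq, huq, hvq⟩ := hpair C hC u hu v hv (hsub huA) (hsub hvA)
            by_cases hqy : q = y
            · subst hqy
              exact ⟨x, hxA', hV'y u huA huq, hV'y v hvA hvq⟩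
            · exact ⟨q, hmem.2 ⟨hqy, hq⟩, huq, hvq⟩)
        rw [← ih', hVF, sum_powerset_union hdisj]
        refine sum_congr rfl fun X hX => ?_
        rw [mem_powerset] at hX
        have hXy : ∀ v, v ∈ X → v ∈ bag y → v ∈ bag x := fun v hv => hV'y v (hX hv)
        -- the sets that contain an eliminated vertex
        have hprod : ∀ U ∈ F.powerset, ∏ C ∈ (X ∪ U).powerset, w C =
            (∏ C ∈ X.powerset, w C) *
              ∏ C ∈ ((X ∩ bag x ∩ bag y) ∪ U).powerset, if C ⊆ bag x then 1 else w C := by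
          intro U hU
          rw [mem_powerset] at hU
          have hUF : ∀ {v}, v ∈ U → v ∈ bag y ∧ v ∉ bag x := fun hv => by
            simpa [hF] using hU hv
          have hsplit := prod_filter_mul_prod_filter_not (X ∪ U).powerset (fun C => C ⊆ X) w
          rw [← hsplit]
          congr 1
          · refine prod_congr ?_ fun _ _ => rfl
            ext C
            simp only [mem_filter, mem_powerset, and_iff_right_iff_imp]
            exact fun h => h.trans subset_union_left
          · rw [prod_ite, prod_const_one, one_mul]
            symm
            -- The sets not inside X that are lost here have weight 1. A set of other weight that
            -- contains an eliminated vertex v shares with v, element by element, a remaining bag;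
            -- that can only be `bag y`, so the whole set lies in the smaller index set.
            refine prod_subset_one_on_sdiff ?_ ?_ fun _ _ => rfl
            · intro C hC
              rw [mem_filter, mem_powerset] at hC ⊢
              refine ⟨hC.1.trans (union_subset_union_left
                (inter_subset_left.trans inter_subset_left)), fun hCX => hC.2 fun v hv => ?_⟩
              rcases mem_union.1 (hC.1 hv) with h | h
              · exact (mem_inter.1 (mem_inter.1 h).1).2
              · exact hXy v (hCX hv) (hUF h).1
            · intro C hC
              rw [mem_sdiff, mem_filter, mem_filter, mem_powerset, mem_powerset] at hC
              by_contra hw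
              obtain ⟨⟨hC1, hC2⟩, hC3⟩ := hC
              obtain ⟨v, hv, hvX⟩ := not_subset.1 hC2
              have hvU : v ∈ U := (mem_union.1 (hC1 hv)).resolve_left hvX
              have hCA : ∀ u ∈ C, u ∈ A.biUnion bag := by
                intro u hu
                rw [hVF]
                exact union_subset_union hX hU (hC1 hu)
              refine hC3 ⟨fun u hu => ?_, fun h => (hUF hvU).2 (h hv)⟩
              obtain ⟨q, hq, huq, hvq⟩ := hpair C hw u hu v hv (hCA u hu) (hCA v hv)
              have hqy : q = y := by
                by_contra hqy
                exact (hUF hvU).2 (hint q (hmem.2 ⟨hqy, hq⟩) v (hUF hvU).1 hvq)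
              subst hqy
              rcases mem_union.1 (hC1 hu) with h | h
              · exact mem_union_left _ (mem_inter.2 ⟨mem_inter.2 ⟨h, hXy u h huq⟩, huq⟩)
              · exact mem_union_right _ h
        -- the messages
        have hmsg : ∀ U ∈ F.powerset, (∏ q ∈ A, ∏ z, if z ∉ A ∧ child q z then
            message w (bag q) (bag z) (g z) ((X ∪ U) ∩ bag q ∩ bag z) else 1) =
            (∏ q ∈ A', ∏ z, if z ∉ A ∧ child q z then
              message w (bag q) (bag z) (g z) (X ∩ bag q ∩ bag z) else 1) *
              g y ((X ∩ bag x ∩ bag y) ∪ U) := by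
          intro U hU
          rw [mem_powerset] at hU
          rw [← mul_prod_erase A _ hyA, mul_comm]
          congr 1
          · refine prod_congr rfl fun q hq => prod_congr rfl fun z _ => ?_
            have : (X ∪ U) ∩ bag q = X ∩ bag q := by
              rw [union_inter_distrib_right, union_eq_left]
              intro v hv
              rw [mem_inter] at hv
              have h1 := mem_sdiff.1 (hU hv.1)
              exact absurd (hint q hq v h1.1 hv.2) h1.2
            rw [this]
          · rw [hg y]
            refine prod_congr rfl fun z _ => ?_
            -- As y is deepest, all its children have been removed, so all their messages are
            -- present and multiply to the table of y.
            have hz : child y z → z ∉ A := fun h hzA => by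
              have := hymax z hzA
              have := depth_child _ _ h
              omega
            have : (X ∪ U) ∩ bag y = (X ∩ bag x ∩ bag y) ∪ U := by
              ext v
              have h1 := @hU v
              have h2 := hXy v
              simp only [hF, mem_sdiff, mem_inter, mem_union] at h1 ⊢
              tauto
            rw [this]
            by_cases h : child y z
            · rw [if_pos ⟨hz h, h⟩, if_pos h]
            · rw [if_neg fun h' => h h'.2, if_neg h]
        have hnew : (∏ q ∈ A', ∏ z, if z ∉ A' ∧ child q z then
            message w (bag q) (bag z) (g z) (X ∩ bag q ∩ bag z) else 1) =
            (∏ q ∈ A', ∏ z, if z ∉ A ∧ child q z then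
              message w (bag q) (bag z) (g z) (X ∩ bag q ∩ bag z) else 1) *
            message w (bag x) (bag y) (g y) (X ∩ bag x ∩ bag y) := by
          have h1 : message w (bag x) (bag y) (g y) (X ∩ bag x ∩ bag y) =
              ∏ q ∈ A', ∏ z, if q = x then if z = y then
                message w (bag q) (bag z) (g z) (X ∩ bag q ∩ bag z) else 1 else 1 := by
            rw [prod_eq_single_of_mem x hxA', prod_eq_single_of_mem y (mem_univ y)]
            · simp
            · intro z _ hz; simp [hz]
            · intro q _ hq; simp [hq]
          rw [h1, ← prod_mul_distrib]
          refine prod_congr rfl fun q hq => ?_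
          rw [← prod_mul_distrib]
          refine prod_congr rfl fun z _ => ?_
          by_cases hzy : z = y
          · subst hzy
            have hq' : child q z ↔ q = x := ⟨fun h => parent_unique _ _ _ h hxy, fun h => h ▸ hxy⟩
            simp [hmem, hyA, hq']
          · simp [hmem, hzy]
        rw [hnew, message, mul_sum, mul_sum, mul_sum]
        refine sum_congr rfl fun U hU => ?_
        have hU' := mem_powerset.1 hU
        rw [hprod U hU, hmsg U hU]
        have hcard := card_union_sdiff_union hdisj hX hU'
        rw [hcard, pow_add]
        ring
  have hcov : (univ : Finset ι).biUnion bag = univ := by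
    ext v
    simpa using bag_cover v
  have := main _ univ rfl (mem_univ _) (fun _ _ _ _ => mem_univ _)
    (fun C hC u hu v hv _ _ => by simpa using w_pair C hC u hu v hv)
  rw [← this, hcov, powerset_univ]
  simp

end Elimination

end CliquePartition

namespace CliquePartition

/-! ### Covers by families of sets -/

section Families

open Finset

/-- In terms of complements this is the alternating sum over the subsets of Sᶜ, which vanishes
unless Sᶜ is empty. -/
theorem sum_neg_one_pow_card_compl {V R : Type*} [Fintype V] [DecidableEq V] [CommRing R]
    (S : Finset V) :
    (∑ X : Finset V, if S ⊆ X then (-1 : R) ^ (univ \ X).card else 0) =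
      if S = univ then 1 else 0 := by
  have h1 : (∑ X : Finset V, if S ⊆ X then (-1 : R) ^ (univ \ X).card else 0) =
      ∑ Y ∈ Sᶜ.powerset, (-1 : R) ^ Y.card := by
    rw [← sum_filter]
    refine sum_bij' (fun X _ => Xᶜ) (fun Y _ => Yᶜ) ?_ ?_ ?_ ?_ ?_
    · intro X hX
      simpa using hX
    · intro Y hY
      simp only [mem_filter, mem_univ, true_and, mem_powerset] at hY ⊢
      exact subset_compl_comm.1 hY
    · simp
    · simp
    · intro X _
      rw [compl_eq_univ_sdiff]
  rw [h1]
  have h2 := congrArg (Int.cast : ℤ → R) (sum_powerset_neg_one_pow_card (x := Sᶜ))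
  push_cast at h2
  rw [h2]
  simp

/-- Expanding the product chooses a family F of subsets of X, that is, a family whose union lies in
X. After exchanging the sums, the signs cancel unless the union is everything. -/
theorem sum_prod_powerset_eq_sum_cover {V R : Type*} [Fintype V] [DecidableEq V] [CommRing R]
    (a : Finset V → R) :
    ∑ X : Finset V, (-1) ^ (univ \ X).card * ∏ C ∈ X.powerset, (1 + a C) =
      ∑ F : Finset (Finset V), if F.sup id = univ then ∏ C ∈ F, a C else 0 := by
  have h1 : ∀ X : Finset V, (-1) ^ (univ \ X).card * ∏ C ∈ X.powerset, (1 + a C) =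
      ∑ F : Finset (Finset V),
        (∏ C ∈ F, a C) * if F.sup id ⊆ X then (-1) ^ (univ \ X).card else 0 := by
    intro X
    rw [prod_one_add, mul_sum]
    have : X.powerset.powerset = univ.filter fun F : Finset (Finset V) => F.sup id ⊆ X := by
      ext F
      simp only [mem_powerset, mem_filter, mem_univ, true_and, Finset.sup_le_iff]
      simp [subset_iff]
    rw [this, sum_filter]
    refine sum_congr rfl fun F _ => ?_
    split <;> ring
  rw [sum_congr rfl fun X _ => h1 X, sum_comm]
  refine sum_congr rfl fun F _ => ?_
  rw [← mul_sum, sum_neg_one_pow_card_compl]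
  split <;> ring

/-! ### Clique partitions and their generating function -/

variable {n : ℕ} (G : SimpleGraph (Fin n)) (k r : ℕ)

/-- The families of cliques of sizes `r` and `r - 1` that partition the vertex set. -/
def IsCliqueFamily (F : Finset (Finset (Fin n))) : Prop :=
  (∀ C ∈ F, G.IsClique (C : Set (Fin n)) ∧ (C.card = r ∨ C.card = r - 1)) ∧
    F.sup id = univ ∧ ∑ C ∈ F, C.card = n

/-- A cover of total size at most that of the set is a partition. -/
theorem supIndep_of_sum_card_le {V : Type*} [Fintype V] [DecidableEq V] {F : Finset (Finset V)}
    (hF : F.sup id = univ) (h : ∑ C ∈ F, C.card ≤ Fintype.card V) : F.SupIndep id := by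
  rw [supIndep_iff_pairwiseDisjoint]
  intro C hC C' hC' hne
  rw [Function.onFun, id, id, Finset.disjoint_left]
  intro v hv hv'
  -- If v lies in two members, it can be deleted from one of them without losing the cover, which
  -- then has total size below that of the set.
  have hcov : (univ : Finset V) ⊆ (F.erase C).biUnion id ∪ C.erase v := by
    intro u _
    have hu : u ∈ F.sup id := hF ▸ mem_univ u
    rw [mem_sup] at hu
    obtain ⟨C₁, h1, h2⟩ := hu
    rw [mem_union, mem_biUnion]
    by_cases h3 : C₁ = C
    · subst h3
      by_cases h4 : u = v
      · subst h4
        exact Or.inl ⟨C', mem_erase.2 ⟨hne.symm, hC'⟩, hv'⟩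
      · exact Or.inr (mem_erase.2 ⟨h4, h2⟩)
    · exact Or.inl ⟨C₁, mem_erase.2 ⟨h3, h1⟩, h2⟩
  have h1 := (card_le_card hcov).trans (card_union_le _ _)
  have h2 : ((F.erase C).biUnion id).card ≤ ∑ C ∈ F.erase C, C.card := card_biUnion_le
  have h3 := add_sum_erase F card hC
  have h4 : (C.erase v).card < C.card := card_erase_lt_of_mem hv
  rw [card_univ] at h1
  omega

-- The prescribed number of cliques of size r - 1 carries no information: it follows from the total
-- size n and the number k of larger cliques, as r - 1 ≠ 0. Conversely, a family of total size n
-- that covers is disjoint, and r ≥ 2 keeps the empty set out of it.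
open Classical in
theorem cliquePartitionCount_eq_card (hr : 2 ≤ r) :
    cliquePartitionCount G k r =
      (univ.filter fun F : Finset (Finset (Fin n)) =>
        IsCliqueFamily G r F ∧ (F.filter fun C => C.card = r).card = k).card := by
  rw [cliquePartitionCount, ← Fintype.card_coe, ← Nat.card_eq_fintype_card]
  refine Nat.card_eq_of_bijective (fun P => ⟨P.1.parts, ?_⟩) ⟨?_, ?_⟩
  · rw [mem_filter]
    refine ⟨mem_univ _, ⟨P.2.1, P.1.sup_parts, ?_⟩, ?_⟩
    · rw [P.1.sum_card_parts, card_univ, Fintype.card_fin]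
    · convert P.2.2.1
  · rintro P P' h
    simp only [Subtype.mk.injEq] at h
    exact Subtype.ext (Finpartition.ext h)
  · rintro ⟨F, hF⟩
    rw [mem_filter] at hF
    obtain ⟨-, ⟨h1, h2, h3⟩, h4⟩ := hF
    have hbot : ⊥ ∉ F := by
      intro h
      have := (h1 _ h).2
      simp at this
      omega
    refine ⟨⟨⟨F, supIndep_of_sum_card_le h2 (by simp [h3]), h2, hbot⟩, h1, ?_, ?_⟩, rfl⟩
    · convert h4
    · have h5 := sum_filter_add_sum_filter_not F (fun C => C.card = r) card
      have h6 : (F.filter fun C => ¬ C.card = r) = F.filter fun C => C.card = r - 1 := by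
        refine filter_congr fun C hC => ?_
        have := (h1 C hC).2
        omega
      rw [h3, h6, sum_congr rfl fun C hC => (mem_filter.1 hC).2,
        sum_congr rfl fun C hC => (mem_filter.1 hC).2, sum_const, sum_const, h4, smul_eq_mul,
        smul_eq_mul] at h5
      have h7 := congrArg (Nat.cast : ℕ → ℚ) h5
      push_cast [Nat.cast_sub (by omega : 1 ≤ r)] at h7
      have hr' : (r : ℚ) - 1 ≠ 0 := by
        have : (2 : ℚ) ≤ r := by exact_mod_cast hr
        linarith
      rw [eq_div_iff hr', ← h7]
      ring_nf

theorem card_filter_le_of_isCliqueFamily (hr : 2 ≤ r) {F : Finset (Finset (Fin n))}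
    (hF : IsCliqueFamily G r F) : (F.filter fun C => C.card = r).card ≤ n := by
  obtain ⟨-, -, h⟩ := hF
  calc (F.filter fun C => C.card = r).card
      = ∑ C ∈ F.filter fun C => C.card = r, 1 := by simp
    _ ≤ ∑ C ∈ F.filter fun C => C.card = r, C.card :=
      sum_le_sum fun C hC => by rw [(mem_filter.1 hC).2]; omega
    _ ≤ ∑ C ∈ F, C.card := sum_le_sum_of_subset (filter_subset _ _)
    _ = n := h

theorem cliquePartitionCount_eq_zero (hr : 2 ≤ r) (hk : n < k) :
    cliquePartitionCount G k r = 0 := by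
  classical
  rw [cliquePartitionCount_eq_card G k r hr, card_eq_zero, filter_eq_empty_iff]
  rintro F - ⟨h1, h2⟩
  have := card_filter_le_of_isCliqueFamily G r hr h1
  omega

/-- A partition is determined by the map that sends a vertex to its part. -/
theorem cliquePartitionCount_le : cliquePartitionCount G k r ≤ (2 ^ n) ^ n := by
  have h : Nat.card (Fin n → Finset (Fin n)) = (2 ^ n) ^ n := by simp
  rw [cliquePartitionCount, ← h]
  refine Nat.card_le_card_of_injective (fun P v => P.1.part v) fun P P' h => ?_
  have key : ∀ {P P' : Finpartition (univ : Finset (Fin n))}, (∀ v, P.part v = P'.part v) →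
      P.parts ⊆ P'.parts := by
    intro P P' h C hC
    obtain ⟨v, hv⟩ := P.nonempty_of_mem_parts hC
    rw [← P.part_eq_of_mem hC hv, h v]
    exact P'.part_mem.2 (mem_univ v)
  exact Subtype.ext (Finpartition.ext (Subset.antisymm (key fun v => congrFun h v)
    (key fun v => (congrFun h v).symm)))

open Classical in
/-- The weight of a clique in the generating function. -/
noncomputable def cliqueTerm (b z : ℕ) (C : Finset (Fin n)) : ℕ :=
  if G.IsClique (C : Set (Fin n)) then
    (if C.card = r then b ^ C.card * z else 0) + if C.card + 1 = r then b ^ C.card else 0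
  else 0

theorem prod_cliqueTerm (hr : 2 ≤ r) (b z : ℕ) (F : Finset (Finset (Fin n)))
    (hF : ∀ C ∈ F, G.IsClique (C : Set (Fin n)) ∧ (C.card = r ∨ C.card = r - 1)) :
    ∏ C ∈ F, cliqueTerm G r b z C =
      b ^ (∑ C ∈ F, C.card) * z ^ (F.filter fun C => C.card = r).card := by
  classical
  rw [← prod_pow_eq_pow_sum, ← prod_const, prod_filter, ← prod_mul_distrib]
  refine prod_congr rfl fun C hC => ?_
  rw [cliqueTerm, if_pos (hF C hC).1]
  rcases (hF C hC).2 with h | h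
  · rw [if_pos h, if_neg (by omega), if_pos h, add_zero]
  · rw [if_neg (by omega), if_pos (by omega), if_neg (by omega), zero_add, mul_one]

/-- A cover with a member that is not a clique of an admissible size contributes 0. The others
contribute b to the total size, which is at least n: exactly n for the partitions, and more for
covers with overlaps, which go into the multiple of b^(n+1). -/
theorem sum_cover_cliqueTerm (hr : 2 ≤ r) (b z : ℕ) :
    ∃ K, (∑ F : Finset (Finset (Fin n)),
        if F.sup id = univ then ∏ C ∈ F, cliqueTerm G r b z C else 0) =
      b ^ n * ∑ i ∈ range (n + 1), cliquePartitionCount G i r * z ^ i + b ^ (n + 1) * K := by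
  classical
  have h1 : ∀ F : Finset (Finset (Fin n)), ∃ K,
      (if F.sup id = univ then ∏ C ∈ F, cliqueTerm G r b z C else 0) =
        (if IsCliqueFamily G r F then b ^ n * z ^ (F.filter fun C => C.card = r).card else 0) +
          b ^ (n + 1) * K := by
    intro F
    by_cases hs : F.sup id = univ
    · by_cases hF : ∀ C ∈ F, G.IsClique (C : Set (Fin n)) ∧ (C.card = r ∨ C.card = r - 1)
      · rw [if_pos hs, prod_cliqueTerm G r hr b z F hF]
        by_cases hn : ∑ C ∈ F, C.card = n
        · exact ⟨0, by rw [if_pos ⟨hF, hs, hn⟩, hn]; ring⟩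
        · rw [if_neg fun h => hn h.2.2]
          have : n ≤ ∑ C ∈ F, C.card := by
            have h : (F.biUnion id).card ≤ ∑ C ∈ F, C.card := card_biUnion_le
            rwa [← sup_eq_biUnion, hs, card_univ, Fintype.card_fin] at h
          obtain ⟨e, he⟩ : ∃ e, ∑ C ∈ F, C.card = n + 1 + e :=
            Nat.exists_eq_add_of_le (by omega)
          exact ⟨b ^ e * z ^ (F.filter fun C => C.card = r).card, by rw [he]; ring⟩
      · rw [if_pos hs, if_neg fun h => hF h.1]
        push Not at hF
        obtain ⟨C, hC, h⟩ := hF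
        refine ⟨0, ?_⟩
        rw [prod_eq_zero hC, zero_add, mul_zero]
        rw [cliqueTerm]
        split
        · rename_i hcl
          have := h hcl
          rw [if_neg (by omega), if_neg (by omega), add_zero]
        · rfl
    · rw [if_neg hs, if_neg fun h => hs h.2.1]
      exact ⟨0, by ring⟩
  choose K hK using h1
  refine ⟨∑ F, K F, ?_⟩
  rw [sum_congr rfl fun F _ => hK F, sum_add_distrib, ← mul_sum]
  congr 1
  rw [← sum_filter, ← mul_sum]
  congr 1
  -- The partitions are grouped by the number of their cliques of size r, which is at most n.
  rw [← sum_fiberwise_of_maps_to (t := range (n + 1))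
    (g := fun F : Finset (Finset (Fin n)) => (F.filter fun C => C.card = r).card)]
  · refine sum_congr rfl fun i _ => ?_
    rw [sum_congr rfl fun F hF => by rw [(mem_filter.1 hF).2], sum_const, smul_eq_mul,
      filter_filter, cliquePartitionCount_eq_card G i r hr]
  · intro F hF
    rw [mem_range, Nat.lt_succ_iff]
    exact card_filter_le_of_isCliqueFamily G r hr (mem_filter.1 hF).2

end Families

/-! ### Digits -/

theorem sum_digits_lt {z : ℕ} {p : ℕ → ℕ} (hp : ∀ i, p i < z) (m : ℕ) :
    ∑ i ∈ Finset.range m, p i * z ^ i < z ^ m := by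
  induction m with
  | zero => simp
  | succ m ih =>
    rw [Finset.sum_range_succ, pow_succ]
    have := Nat.mul_le_mul_right (z ^ m) (hp m)
    rw [Nat.succ_mul] at this
    linarith [mul_comm z (z ^ m)]

theorem sum_digits_succ {z : ℕ} (p : ℕ → ℕ) (m : ℕ) :
    ∑ i ∈ Finset.range (m + 1), p i * z ^ i =
      p 0 + z * ∑ i ∈ Finset.range m, p (i + 1) * z ^ i := by
  rw [Finset.sum_range_succ', Finset.mul_sum, add_comm]
  congr 1
  · simp
  · exact Finset.sum_congr rfl fun i _ => by ring

end CliquePartition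

namespace CliquePartition

/-! ### Subsets as numbers -/

section Bits

open Finset

/-- The set of vertices whose bit in `M` is set. -/
def bits (n M : ℕ) : Finset (Fin n) := univ.filter fun v => M / 2 ^ (v : ℕ) % 2 = 1

theorem mem_bits {n M : ℕ} {v : Fin n} : v ∈ bits n M ↔ M / 2 ^ (v : ℕ) % 2 = 1 := by
  simp [bits]

theorem div_pow_mod_two {n : ℕ} (M : ℕ) (v : Fin n) [Decidable (v ∈ bits n M)] :
    M / 2 ^ (v : ℕ) % 2 = if v ∈ bits n M then 1 else 0 := by
  split
  · exact mem_bits.1 ‹_›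
  · rename_i h
    rw [mem_bits] at h
    omega

theorem bits_zero (n : ℕ) : bits n 0 = ∅ := by simp [bits]

/-- Adding 2^v where that bit is zero produces no carry. -/
theorem div_pow_add_pow_mod_two {M v : ℕ} (hv : M / 2 ^ v % 2 = 0) (j : ℕ) :
    (M + 2 ^ v) / 2 ^ j % 2 = if j = v then 1 else M / 2 ^ j % 2 := by
  rcases lt_trichotomy j v with h | h | h
  · rw [if_neg h.ne]
    obtain ⟨d, rfl⟩ := Nat.exists_eq_add_of_lt h
    have : 2 ^ (j + d + 1) = 2 ^ j * (2 * 2 ^ d) := by ring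
    rw [this, Nat.add_mul_div_left _ _ (by positivity), Nat.add_mul_mod_self_left]
  · subst h
    rw [if_pos rfl, Nat.add_div_right _ (by positivity)]
    omega
  · rw [if_neg h.ne']
    obtain ⟨d, rfl⟩ := Nat.exists_eq_add_of_lt h
    have : 2 ^ (v + d + 1) = 2 ^ v * (2 * 2 ^ d) := by ring
    rw [this, ← Nat.div_div_eq_div_mul, ← Nat.div_div_eq_div_mul, ← Nat.div_div_eq_div_mul,
      ← Nat.div_div_eq_div_mul, Nat.add_div_right _ (by positivity)]
    congr 2
    omega

theorem bits_add_pow {n M : ℕ} {v : Fin n} (hv : v ∉ bits n M) :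
    bits n (M + 2 ^ (v : ℕ)) = insert v (bits n M) := by
  ext j
  rw [mem_bits] at hv
  rw [mem_insert, mem_bits, mem_bits, div_pow_add_pow_mod_two (by omega)]
  split
  · rename_i h
    simp [Fin.ext h]
  · rename_i h
    have : j ≠ v := fun h' => h (congrArg _ h')
    simp [this]

theorem pow_le_of_mem_bits {n M : ℕ} {v : Fin n} (hv : v ∈ bits n M) : 2 ^ (v : ℕ) ≤ M := by
  rw [mem_bits] at hv
  by_contra h
  rw [Nat.div_eq_of_lt (by omega)] at hv
  simp at hv

theorem bits_sub_pow {n M : ℕ} {v : Fin n} (hv : v ∈ bits n M) :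
    bits n (M - 2 ^ (v : ℕ)) = (bits n M).erase v := by
  have h1 := pow_le_of_mem_bits hv
  have h2 : v ∉ bits n (M - 2 ^ (v : ℕ)) := by
    rw [mem_bits] at hv ⊢
    rw [← Nat.sub_add_cancel h1, Nat.add_div_right _ (by positivity)] at hv
    omega
  have h3 := bits_add_pow h2
  rw [Nat.sub_add_cancel h1] at h3
  rw [h3, erase_insert h2]

theorem lt_two_pow_of_lt_succ {M v : ℕ} (h : M < 2 ^ (v + 1)) (h' : M / 2 ^ v % 2 = 0) :
    M < 2 ^ v := by
  have h1 : M / 2 ^ v < 2 := by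
    rw [Nat.div_lt_iff_lt_mul (by positivity)]
    rw [pow_succ] at h
    linarith
  have : M / 2 ^ v = 0 := by
    rcases Nat.lt_succ_iff.1 h1 |>.lt_or_eq with h2 | h2 <;> simp_all
  rcases Nat.div_eq_zero_iff.1 this with h2 | h2
  · exact absurd h2 (by positivity)
  · exact h2

/-- The quotient of M by 2^v is even and lies below an even bound, so it can be raised by one. -/
theorem add_pow_lt_of_notMem_bits {n M : ℕ} {v : Fin n} (hM : M < 2 ^ n) (hv : v ∉ bits n M) :
    M + 2 ^ (v : ℕ) < 2 ^ n := by
  obtain ⟨d, hd⟩ := Nat.exists_eq_add_of_lt v.2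
  rw [mem_bits] at hv
  set q := 2 ^ (v : ℕ) with hq
  have hq0 : 0 < q := by positivity
  have hn : 2 ^ n = q * (2 * 2 ^ d) := by
    conv_lhs => rw [hd]
    rw [hq]
    ring
  rw [hn] at hM ⊢
  have h1 : M / q < 2 * 2 ^ d := by
    rw [Nat.div_lt_iff_lt_mul hq0]
    linarith
  have h2 : M / q + 1 < 2 * 2 ^ d := by omega
  calc M + q < q * (M / q + 1) + q := by
        have := Nat.lt_mul_div_succ M hq0
        omega
    _ = q * (M / q + 1 + 1) := by ring
    _ ≤ q * (2 * 2 ^ d) := Nat.mul_le_mul_left _ h2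

end Bits

/-! ### Transforms in layers -/

section Layers

open Finset

variable {n : ℕ} {R : Type*} [CommRing R]

theorem filter_val_lt_succ (S : Finset (Fin n)) {v : ℕ} (hv : v < n) :
    S.filter (fun u : Fin n => (u : ℕ) < v + 1) =
      if (⟨v, hv⟩ : Fin n) ∈ S then insert ⟨v, hv⟩ (S.filter fun u : Fin n => (u : ℕ) < v)
      else S.filter fun u : Fin n => (u : ℕ) < v := by
  split
  · rename_i h
    ext u
    simp only [mem_filter, mem_insert, Fin.ext_iff]
    constructor
    · rintro ⟨h1, h2⟩
      by_cases h3 : (u : ℕ) = v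
      · exact Or.inl h3
      · exact Or.inr ⟨h1, by omega⟩
    · rintro (h1 | h1)
      · have : u = ⟨v, hv⟩ := Fin.ext h1
        subst this
        exact ⟨h, by simp⟩
      · exact ⟨h1.1, by omega⟩
  · rename_i h
    refine filter_congr fun u hu => ?_
    have : (u : ℕ) ≠ v := fun h' => h (by rwa [show (⟨v, hv⟩ : Fin n) = u from Fin.ext h'.symm])
    omega

theorem filter_val_lt_self (S : Finset (Fin n)) : S.filter (fun u : Fin n => (u : ℕ) < n) = S :=
  filter_true_of_mem fun u _ => u.2

/-- The product of `f` over the subsets of `S` that contain all elements of `S` from `v` on. -/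
def prodLayer (f : Finset (Fin n) → R) (v : ℕ) (S : Finset (Fin n)) : R :=
  ∏ C ∈ (S.filter fun u : Fin n => (u : ℕ) < v).powerset, f (C ∪ S.filter fun u : Fin n => ¬(u : ℕ) < v)

theorem prodLayer_zero (f : Finset (Fin n) → R) (S : Finset (Fin n)) :
    prodLayer f 0 S = f S := by
  simp [prodLayer]

theorem prodLayer_card (f : Finset (Fin n) → R) (S : Finset (Fin n)) :
    prodLayer f n S = ∏ C ∈ S.powerset, f C := by
  simp [prodLayer]

/-- The subsets are split by whether they contain v. So n passes over the table yield all products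
over subsets, where multiplying out directly would cost 3^|bag|. -/
theorem prodLayer_succ (f : Finset (Fin n) → R) {v : ℕ} (hv : v < n) (S : Finset (Fin n)) :
    prodLayer f (v + 1) S =
      if (⟨v, hv⟩ : Fin n) ∈ S then prodLayer f v S * prodLayer f v (S.erase ⟨v, hv⟩)
      else prodLayer f v S := by
  split
  · rename_i h
    have h1 : (⟨v, hv⟩ : Fin n) ∉ S.filter fun u : Fin n => (u : ℕ) < v := by simp
    rw [prodLayer, filter_val_lt_succ S hv, if_pos h, prod_powerset_insert h1, mul_comm,
      prodLayer, prodLayer]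
    congr 1
    · refine prod_congr rfl fun C _ => congrArg f ?_
      ext u
      simp only [mem_union, mem_insert, mem_filter]
      by_cases hu : u = ⟨v, hv⟩
      · subst hu; simp [h]
      · have : (u : ℕ) ≠ v := fun h' => hu (Fin.ext h')
        simp only [hu, false_or]
        rw [show (u : ℕ) < v + 1 ↔ (u : ℕ) < v by omega]
    · have h2 : (S.erase ⟨v, hv⟩).filter (fun u : Fin n => (u : ℕ) < v) =
          S.filter fun u : Fin n => (u : ℕ) < v := by
        rw [filter_erase, erase_eq_of_notMem h1]
      rw [h2]
      refine prod_congr rfl fun C _ => congrArg f ?_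
      congr 1
      ext u
      simp only [mem_filter, mem_erase, Fin.ext_iff, Ne]
      constructor <;> rintro ⟨a, b⟩
      · exact ⟨⟨by omega, a⟩, by omega⟩
      · exact ⟨a.2, by omega⟩
  · rename_i h
    have h1 : S.filter (fun u : Fin n => (u : ℕ) < v + 1) = S.filter fun u : Fin n => (u : ℕ) < v := by
      rw [filter_val_lt_succ S hv, if_neg h]
    have h2 : S.filter (fun u : Fin n => ¬(u : ℕ) < v + 1) = S.filter fun u : Fin n => ¬(u : ℕ) < v := by
      rw [filter_not, filter_not, h1]
    rw [prodLayer, prodLayer, h1, h2]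

/-- The signed sum of `f` over all ways to change `S` on the elements of `F` below `v`. -/
def sumLayer (F : Finset (Fin n)) (f : Finset (Fin n) → R) (v : ℕ) (S : Finset (Fin n)) : R :=
  ∑ U ∈ (F.filter fun u : Fin n => (u : ℕ) < v).powerset,
    (-1) ^ ((F.filter fun u : Fin n => (u : ℕ) < v) \ U).card *
      f ((S \ F.filter fun u : Fin n => (u : ℕ) < v) ∪ U)

theorem sumLayer_zero (F : Finset (Fin n)) (f : Finset (Fin n) → R) (S : Finset (Fin n)) :
    sumLayer F f 0 S = f S := by
  simp [sumLayer]

/-- The choices U are split by whether they contain v; leaving v out of U costs a sign. -/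
theorem sumLayer_succ (F : Finset (Fin n)) (f : Finset (Fin n) → R) {v : ℕ} (hv : v < n)
    (S : Finset (Fin n)) :
    sumLayer F f (v + 1) S =
      if (⟨v, hv⟩ : Fin n) ∈ F then
        sumLayer F f v (insert ⟨v, hv⟩ S) - sumLayer F f v (S.erase ⟨v, hv⟩)
      else sumLayer F f v S := by
  split
  · rename_i h
    have h1 : (⟨v, hv⟩ : Fin n) ∉ F.filter fun u : Fin n => (u : ℕ) < v := by simp
    rw [sumLayer, filter_val_lt_succ F hv, if_pos h, sum_powerset_insert h1, sub_eq_add_neg,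
      add_comm, sumLayer, sumLayer, ← sum_neg_distrib]
    set F' := F.filter fun u : Fin n => (u : ℕ) < v
    congr 1
    · refine sum_congr rfl fun U hU => ?_
      have hU' := mem_powerset.1 hU
      have hvU : (⟨v, hv⟩ : Fin n) ∉ U := fun h' => h1 (hU' h')
      have e1 : insert ⟨v, hv⟩ F' \ insert ⟨v, hv⟩ U = F' \ U := by
        rw [insert_sdiff_insert, sdiff_insert_of_notMem h1]
      rw [e1]
      congr 2
      ext u
      simp only [mem_union, mem_insert, mem_sdiff]
      by_cases hu : u = ⟨v, hv⟩
      · subst hu; simp [h1]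
      · simp [hu]
    · refine sum_congr rfl fun U hU => ?_
      have hU' := mem_powerset.1 hU
      have hvU : (⟨v, hv⟩ : Fin n) ∉ U := fun h' => h1 (hU' h')
      have e1 : (insert ⟨v, hv⟩ F' \ U).card = (F' \ U).card + 1 := by
        rw [insert_sdiff_of_notMem _ hvU, card_insert_of_notMem fun h' => h1 (mem_sdiff.1 h').1]
      rw [e1, pow_succ]
      have e2 : (S \ insert ⟨v, hv⟩ F') ∪ U = (S.erase ⟨v, hv⟩ \ F') ∪ U := by
        ext u
        simp only [mem_union, mem_insert, mem_sdiff, mem_erase]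
        tauto
      rw [e2]
      ring
  · rename_i h
    rw [sumLayer, filter_val_lt_succ F hv, if_neg h, sumLayer]

theorem sumLayer_card (w : Finset (Fin n) → R) (Bx By : Finset (Fin n))
    (f : Finset (Fin n) → R) {S : Finset (Fin n)} (hS : S ⊆ Bx) :
    sumLayer (By \ Bx) (fun T => (∏ C ∈ T.powerset, if C ⊆ Bx then 1 else w C) * f T) n S =
      message w Bx By f S := by
  have h : S \ (By \ Bx) = S := by
    rw [Finset.sdiff_eq_self_iff_disjoint, Finset.disjoint_left]
    exact fun v hv hv' => (mem_sdiff.1 hv').2 (hS hv)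
  rw [sumLayer, message, filter_val_lt_self, h]

end Layers

/-! ### The numbers used by the program -/

/-- The number of partitions is less than this number. -/
def digitBase (n : ℕ) : ℕ := (2 ^ (n + 1)) ^ (n + 1)

/-- The weight of an element of a clique. -/
def sizeBase (n : ℕ) : ℕ := digitBase n ^ (n + 1)

/-- The modulus of the tables. -/
def modulus (n : ℕ) : ℕ := sizeBase n ^ n * sizeBase n

/-- All numbers in the tables have at most (n + 1)^4 bits, which keeps logarithmic cost polynomial.
-/
theorem modulus_eq (n : ℕ) : modulus n = 2 ^ (n + 1) ^ 4 := by
  rw [modulus, ← pow_succ, sizeBase, digitBase, ← pow_mul, ← pow_mul, ← pow_mul]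
  congr 1
  ring

theorem digitBase_eq (n : ℕ) : digitBase n = 2 ^ (n + 1) ^ 2 := by
  rw [digitBase, ← pow_mul, sq]

theorem sizeBase_eq (n : ℕ) : sizeBase n = 2 ^ (n + 1) ^ 3 := by
  rw [sizeBase, digitBase_eq, ← pow_mul, ← pow_succ]

theorem two_pow_pow_le {n i j : ℕ} (h : i ≤ j) : 2 ^ (n + 1) ^ i ≤ 2 ^ (n + 1) ^ j :=
  Nat.pow_le_pow_right (by norm_num) (Nat.pow_le_pow_right (by omega) h)

theorem count_lt_digitBase {n : ℕ} (G : SimpleGraph (Fin n)) (k r : ℕ) :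
    cliquePartitionCount G k r < digitBase n := by
  refine (cliquePartitionCount_le G k r).trans_lt ?_
  rw [digitBase_eq, ← pow_mul]
  exact Nat.pow_lt_pow_right (by norm_num) (by nlinarith)

end CliquePartition

namespace CliquePartition

/-! ### The program -/

instance : Add Expr := ⟨.bin .add⟩
instance : Sub Expr := ⟨.bin .sub⟩
instance : Mul Expr := ⟨.bin .mul⟩
instance : Div Expr := ⟨.bin .div⟩
instance : Mod Expr := ⟨.bin .mod⟩

namespace Expr

variable (s : State) (a b : Expr)

@[simp]
theorem eval_add : (a + b).eval s = a.eval s + b.eval s := rfl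
@[simp]
theorem eval_sub : (a - b).eval s = a.eval s - b.eval s := rfl
@[simp]
theorem eval_mul : (a * b).eval s = a.eval s * b.eval s := rfl
@[simp]
theorem eval_div : (a / b).eval s = a.eval s / b.eval s := rfl
@[simp]
theorem eval_mod : (a % b).eval s = a.eval s % b.eval s := rfl
@[simp]
theorem eval_const (c : ℕ) : (const c).eval s = c := rfl
@[simp]
theorem eval_var (x : ℕ) : (var x).eval s = s.var x := rfl
@[simp]
theorem eval_read (x : ℕ) : (read x a).eval s = s.arr x (a.eval s) := rfl
@[simp]
theorem eval_eq : (bin .eq a b).eval s = if a.eval s = b.eval s then 1 else 0 := rfl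
@[simp]
theorem eval_lt : (bin .lt a b).eval s = if a.eval s < b.eval s then 1 else 0 := rfl

/-- The bit number `v` of `x`, for registers `x` and `v`; array `3` stores the powers of two. -/
def bit (x v : ℕ) : Expr := var x / read 3 (var v) % const 2

@[simp]
theorem eval_bit (x v : ℕ) : (bit x v).eval s = s.var x / s.arr 3 (s.var v) % 2 := rfl

end Expr

namespace Program

open CliquePartition.Expr

/-- Registers `5, …, 10` become `n + 1`, `2 ^ (n + 1)`, `digitBase n`, `sizeBase n`,
`sizeBase n ^ n`, `modulus n`; array `3` stores the powers of two. -/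
def setup : Program :=
  .seq (.assign 5 (var 0 + const 1)) <|
  .seq (.assign 6 (const 1)) <|
  .seq (forTo 15 5 (.seq (.write 3 (var 15) (var 6)) (.assign 6 (var 6 * const 2)))) <|
  .seq (.assign 7 (const 1)) <|
  .seq (forTo 15 5 (.assign 7 (var 7 * var 6))) <|
  .seq (.assign 8 (const 1)) <|
  .seq (forTo 15 5 (.assign 8 (var 8 * var 7))) <|
  .seq (.assign 9 (const 1)) <|
  .seq (forTo 15 0 (.assign 9 (var 9 * var 8))) <|
  .assign 10 (var 9 * var 8)

/-- Array `4` lists the subsets of the bag of the node in register `x`, array `5` their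
intersections with the bag of the node in register `y`, register `14` is the length of the
lists. -/
def listSubsets (x y : ℕ) : Program :=
  .seq (.write 4 (const 0) (const 0)) <|
  .seq (.write 5 (const 0) (const 0)) <|
  .seq (.assign 14 (const 1)) <|
  forTo 16 0 (.seq
    (forTo 15 14 (.seq
      (.write 4 (var 14 + var 15) (read 4 (var 15) + read 3 (var 16)))
      (.write 5 (var 14 + var 15)
        (read 5 (var 15) + read 3 (var 16) * read 2 (var y * var 0 + var 16)))))
    (.assign 14 (var 14 + var 14 * read 2 (var x * var 0 + var 16))))

/-- Run `p` for all entries of the list of subsets; register `17` is the current one. -/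
def forSubsets (p : Program) : Program :=
  forTo 15 14 (.seq (.assign 17 (read 4 (var 15))) p)

/-- Register `19` is set to `1` or `0` as the set in register `17` is a clique or not, register
`20` to its size, register `21` to its weight, register `22` to the number of its elements outside
of the bag of the node in register `12`. -/
def inspect : Program :=
  .seq (.assign 19 (const 1)) <|
  .seq (.assign 20 (const 0)) <|
  .seq (.assign 21 (const 1)) <|
  .seq (.assign 22 (const 0)) <|
  forTo 18 0 (
    .seq (.assign 20 (var 20 + bit 17 18)) <|
    .seq (.assign 21 (var 21 * (bit 17 18 * var 8 + (const 1 - bit 17 18)))) <|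
    .seq (.assign 22 (var 22 + bit 17 18 * (const 1 - read 2 (var 12 * var 0 + var 18)))) <|
    forTo 23 0 (.assign 19 (var 19 * (const 1 - bit 17 18 * (bit 17 23 *
      ((const 1 - .bin .eq (var 18) (var 23)) *
        (const 1 - read 0 (var 18 * var 0 + var 23))))))))

/-- The weights of the listed subsets, in array `6`. -/
def cliqueWeights : Program :=
  forSubsets (.seq inspect (.write 6 (var 17)
    ((const 1 + var 19 * (.bin .lt (const 0) (var 22) *
      (.bin .eq (var 20) (var 3) * (var 21 * var 7) +
        .bin .eq (var 20 + const 1) (var 3) * var 21))) % var 10)))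

/-- The products of the weights over the subsets of the listed sets, layer by layer in
array `6`. -/
def subsetProducts : Program :=
  forTo 16 0 (forSubsets (.write 6 ((var 16 + const 1) * var 6 + var 17)
    (read 6 (var 16 * var 6 + var 17) *
      (bit 17 16 * read 6 (var 16 * var 6 + (var 17 - read 3 (var 16))) +
        (const 1 - bit 17 16)) % var 10)))

/-- The products of the last layer of array `6` with the table of the node in register `13`. -/
def tableProducts : Program :=
  forSubsets (.write 7 (var 17)
    (read 6 (var 0 * var 6 + var 17) * read 9 (var 13 * var 6 + var 17) % var 10))

/-- The vertices in the bag of the node in register `13` and outside of that of the node in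
register `12` are summed out, layer by layer in array `7`. -/
def sumOut : Program :=
  forTo 16 0 (.seq
    (.assign 24 (read 2 (var 13 * var 0 + var 16) *
      (const 1 - read 2 (var 12 * var 0 + var 16))))
    (forSubsets (.seq (.assign 25 (var 17 - bit 17 16 * read 3 (var 16)))
      (.write 7 ((var 16 + const 1) * var 6 + var 17)
      ((var 24 * (read 7 (var 16 * var 6 + (var 25 + read 3 (var 16))) +
          (var 10 - const 1) * read 7 (var 16 * var 6 + var 25)) +
        (const 1 - var 24) * read 7 (var 16 * var 6 + var 17)) % var 10)))))

/-- The message of the node in register `13` to the node in register `12`, in the last layer of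
array `7`. -/
def sendMessage : Program :=
  .seq (listSubsets 13 12) <|
  .seq cliqueWeights <|
  .seq subsetProducts <|
  .seq tableProducts sumOut

/-- Array `8` is multiplied by the message, if the node in register `13` is a child. -/
def receiveMessage : Program :=
  forSubsets (.write 8 ((var 13 + const 1) * var 6 + var 17)
    (read 8 (var 13 * var 6 + var 17) *
      (read 1 (var 12 * var 1 + var 13) * read 7 (var 0 * var 6 + read 5 (var 15)) +
        (const 1 - read 1 (var 12 * var 1 + var 13))) % var 10))

/-- The table of the node in register `12`, in array `9`, from those of its children. -/
def processNode : Program :=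
  .seq (listSubsets 12 12) <|
  .seq (forSubsets (.write 8 (var 17) (const 1))) <|
  .seq (forTo 13 1 (.seq sendMessage (.seq (listSubsets 12 13) receiveMessage))) <|
  .seq (listSubsets 12 12) <|
  forSubsets (.write 9 (var 12 * var 6 + var 17) (read 8 (var 1 * var 6 + var 17)))

/-- Register `0` becomes the coefficient that is asked for. -/
def extract : Program :=
  .seq (.assign 24 (read 9 (var 4 * var 6) % var 10 / var 9)) <|
  .seq (.assign 25 (const 0)) <|
  .seq (forTo 15 5 (
    .seq (.assign 25 (var 25 + .bin .eq (var 15) (var 2) * (var 24 % var 7))) <|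
    .assign 24 (var 24 / var 7))) <|
  .assign 0 (var 25)

/-- The program that counts partitions into cliques. -/
def main : Program :=
  .seq setup <|
  .seq (forTo 11 1 (forTo 12 1 processNode)) extract

end Program

/-! ### Correctness of the program -/

section Verification

variable {n N : ℕ} {G : SimpleGraph (Fin n)} (D : TreeDecomposition G (Fin N)) (root : Fin N)
  (k r : ℕ)

open Classical in
theorem matrixArray_apply {a b : ℕ} (R : Fin a → Fin b → Prop) (u : Fin a) (v : Fin b) :
    matrixArray R ((u : ℕ) * b + v) = if R u v then 1 else 0 := by
  unfold matrixArray
  congr 1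
  rw [eq_iff_iff]
  constructor
  · rintro ⟨u', v', h, hR⟩
    have hv : v = v' := by
      have := congrArg (· % b) h
      simp only [Nat.mul_add_mod', Nat.mod_eq_of_lt v.2, Nat.mod_eq_of_lt v'.2] at this
      exact Fin.ext this
    have hu : u = u' := by
      have hb : 0 < b := by have := v.2; omega
      rw [hv] at h
      have := Nat.eq_of_mul_eq_mul_right hb (Nat.add_right_cancel h)
      exact Fin.ext this
    rwa [hu, hv]
  · exact fun h => ⟨u, v, rfl, h⟩

/-- The registers and arrays that are fixed once the setup is done. -/
structure Env (s : State) : Prop where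
  v0 : s.var 0 = n
  v1 : s.var 1 = N
  v2 : s.var 2 = k
  v3 : s.var 3 = r
  v4 : s.var 4 = root
  v5 : s.var 5 = n + 1
  v6 : s.var 6 = 2 ^ (n + 1)
  v7 : s.var 7 = digitBase n
  v8 : s.var 8 = sizeBase n
  v9 : s.var 9 = sizeBase n ^ n
  v10 : s.var 10 = modulus n
  a0 : s.arr 0 = matrixArray G.Adj
  a1 : s.arr 1 = matrixArray (D.IsChild root)
  a2 : s.arr 2 = matrixArray fun x v => v ∈ D.bag x
  a3 : ∀ v, v ≤ n → s.arr 3 v = 2 ^ v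

variable {D root k r}

theorem Env.frame {s s' : State} (h : Env D root k r s) {vs as : List ℕ} (hF : Frame vs as s s')
    (hv : ∀ x ∈ vs, 10 < x) (ha : ∀ a ∈ as, 3 < a) : Env D root k r s' := by
  have h1 : ∀ x, x ≤ 10 → s'.var x = s.var x := fun x hx => hF.1 x fun h => by
    have := hv x h
    omega
  have h2 : ∀ a, a ≤ 3 → s'.arr a = s.arr a := fun a hx => hF.2 a fun h => by
    have := ha a h
    omega
  constructor
  · rw [h1 _ (by norm_num), h.v0]
  · rw [h1 _ (by norm_num), h.v1]
  · rw [h1 _ (by norm_num), h.v2]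
  · rw [h1 _ (by norm_num), h.v3]
  · rw [h1 _ (by norm_num), h.v4]
  · rw [h1 _ (by norm_num), h.v5]
  · rw [h1 _ (by norm_num), h.v6]
  · rw [h1 _ (by norm_num), h.v7]
  · rw [h1 _ (by norm_num), h.v8]
  · rw [h1 _ (by norm_num), h.v9]
  · rw [h1 _ (by norm_num), h.v10]
  · rw [h2 _ (by norm_num), h.a0]
  · rw [h2 _ (by norm_num), h.a1]
  · rw [h2 _ (by norm_num), h.a2]
  · intro v hv
    rw [h2 _ (by norm_num), h.a3 v hv]

open Classical in
theorem Env.bag {s : State} (h : Env D root k r s) (x : Fin N) (v : Fin n) :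
    s.arr 2 (x * n + v) = if v ∈ D.bag x then 1 else 0 := by
  rw [h.a2, matrixArray_apply]; congr

open Classical in
theorem Env.adj {s : State} (h : Env D root k r s) (u v : Fin n) :
    s.arr 0 (u * n + v) = if G.Adj u v then 1 else 0 := by
  rw [h.a0]; exact matrixArray_apply _ u v

open Classical in
theorem Env.child {s : State} (h : Env D root k r s) (x y : Fin N) :
    s.arr 1 (x * N + y) = if D.IsChild root x y then 1 else 0 := by
  rw [h.a1]; exact matrixArray_apply _ x y

/-- The contents of array `4`, array `5` and register `14` after `listSubsets`. -/
structure SubsetList (X Y : Finset (Fin n)) (s : State) : Prop where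
  len : s.var 14 = 2 ^ X.card
  lt : ∀ i < s.var 14, s.arr 4 i < 2 ^ n
  subset : ∀ i < s.var 14, bits n (s.arr 4 i) ⊆ X
  lt' : ∀ i < s.var 14, s.arr 5 i < 2 ^ n
  inter : ∀ i < s.var 14, bits n (s.arr 5 i) = bits n (s.arr 4 i) ∩ Y
  complete : ∀ M < 2 ^ n, bits n M ⊆ X → ∃ i < s.var 14, s.arr 4 i = M

theorem SubsetList.frame {X Y : Finset (Fin n)} {s s' : State} (h : SubsetList X Y s)
    {vs as : List ℕ} (hF : Frame vs as s s') (hv : 14 ∉ vs) (h4 : 4 ∉ as) (h5 : 5 ∉ as) :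
    SubsetList X Y s' := by
  have e1 := hF.1 14 hv
  have e2 := hF.2 4 h4
  have e3 := hF.2 5 h5
  constructor <;> rw [e1] <;> try rw [e2]
  · exact h.len
  · exact h.lt
  · exact h.subset
  · rw [e3]; exact h.lt'
  · rw [e3]; exact h.inter
  · exact h.complete

variable {W B : ℕ}

/-- The body fills the window of array `a` at `base`, indexed by masks, and everything outside the
window survives. The value depends on the mask alone, so the list need not be free of repetitions: a
second visit rewrites the same residue. Values are specified in a ring R because tables matter only
modulo `modulus n`. -/
theorem Triple.forSubsets {p : Program} {s₀ : State} {T a base : ℕ} {X Y : Finset (Fin n)}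
    {R : Type*} [CommRing R] (f : ℕ → R)
    (hs₀ : SubsetList X Y s₀) (hB : 2 ^ n ≤ 2 ^ B)
    (h14 : 14 ∉ p.vars) (h15 : 15 ∉ p.vars)
    (h4 : 4 ∉ p.arrs)
    (hstep : ∀ s j, j < s₀.var 14 → s.var 15 = j → s.var 17 = s₀.arr 4 j →
      s.var 17 < 2 ^ n → bits n (s.var 17) ⊆ X →
      Frame (17 :: 15 :: p.vars) p.arrs s₀ s →
      (∀ i, (∀ M < 2 ^ n, i ≠ base + M) → s.arr a i = s₀.arr a i) →
      Triple W B p s T fun s' => ∃ val : ℕ, (val : R) = f (s.var 17) ∧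
        s'.arr a = Function.update (s.arr a) (base + s.var 17) val) :
    Triple W B (Program.forSubsets p) s₀ (2 ^ X.card * (T + 6) + 3) fun s' =>
      (∀ M < 2 ^ n, bits n M ⊆ X → (s'.arr a (base + M) : R) = f M) ∧
      ∀ i, (∀ M < 2 ^ n, i ≠ base + M) → s'.arr a i = s₀.arr a i := by
  have hv : (Program.seq (.assign 17 (.read 4 (.var 15))) p).vars = 17 :: p.vars := rfl
  have ha : (Program.seq (.assign 17 (.read 4 (.var 15))) p).arrs = p.arrs := rfl
  refine (Triple.forLoop (T := T + 2) (fun i s =>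
    (∀ j < i, (s.arr a (base + s₀.arr 4 j) : R) = f (s₀.arr 4 j)) ∧
      ∀ i, (∀ M < 2 ^ n, i ≠ base + M) → s.arr a i = s₀.arr a i) ?_ ?_ ?_ ?_).mono ?_ ?_
  · rw [hv]; simp [h14]
  · rw [hv]; simp [h15]
  · exact ⟨fun j hj => absurd hj (by omega), fun _ _ => rfl⟩
  · intro i s hi hsi hF hI
    have e4 : s.arr 4 = s₀.arr 4 := hF.2 4 (by rwa [ha])
    have hlt := hs₀.lt i hi
    have hsub := hs₀.subset i hi
    refine Triple.assign_seq (by rw [Expr.eval_read, Expr.eval_var, hsi, e4]; omega) ?_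
    rw [Expr.eval_read, Expr.eval_var, hsi, e4]
    refine (hstep _ i hi (by simp [State.setVar_var, hsi]) (by simp [State.setVar_var])
      (by simpa [State.setVar_var] using hlt) (by simpa [State.setVar_var] using hsub)
      ⟨fun x hx => ?_, fun b hb => ?_⟩ ?_).mono le_rfl ?_
    · rw [State.setVar_var, if_neg fun h => hx (by simp [h])]
      refine hF.1 x fun h => hx ?_
      rw [hv] at h
      simp only [List.mem_cons] at h ⊢
      tauto
    · exact hF.2 b hb
    · exact hI.2
    · rintro s' hF' ⟨val, hval, hs'⟩
      rw [State.setVar_arr] at hs'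
      simp only [State.setVar_var, if_true] at hs' hval
      rw [State.setVar_arr, hs']
      constructor
      · intro j hj
        rw [Function.update_apply]
        split
        · rename_i h
          rw [hval, Nat.add_left_cancel h]
        · rename_i h
          refine hI.1 j ?_
          rcases Nat.lt_succ_iff_lt_or_eq.1 hj with h' | h'
          · exact h'
          · rw [h'] at h
            exact absurd rfl h
      · intro j hj
        rw [Function.update_of_ne (hj _ hlt), hI.2 j hj]
  · rw [hs₀.len]
  · rintro s' - ⟨h1, h2⟩
    refine ⟨fun M hM hMX => ?_, h2⟩
    obtain ⟨i, hi, rfl⟩ := hs₀.complete M hM hMX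
    exact h1 i hi

end Verification

end CliquePartition

namespace CliquePartition

/-! ### Listing the subsets of a bag -/

section Verification

variable {n N : ℕ} {G : SimpleGraph (Fin n)} {D : TreeDecomposition G (Fin N)} {root : Fin N}
  {k r : ℕ} {W B : ℕ}

open Finset

theorem notMem_bits_of_lt {M v : ℕ} (hv : v < n) (hM : M < 2 ^ v) :
    (⟨v, hv⟩ : Fin n) ∉ bits n M := by
  rw [mem_bits]
  simp [Nat.div_eq_of_lt hM]

/-- The list is built by doubling. For each vertex v a shifted copy of the list with bit v added is
always appended, but the length is doubled only if v lies in the bag; otherwise the copy is garbage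
beyond the end. Thus the work is proportional to the number of subsets of the bag and not to 2^n. -/
theorem Triple.listSubsets {x y : ℕ} {s₀ : State} {xi yi : Fin N} {L : ℕ}
    (hE : Env D root k r s₀) (hx : s₀.var x = xi) (hy : s₀.var y = yi)
    (hx' : x = 12 ∨ x = 13) (hy' : y = 12 ∨ y = 13) (hB : 2 ^ (n + 1) ≤ 2 ^ B)
    (hL : 2 ^ (D.bag xi).card ≤ L) :
    Triple W B (Program.listSubsets x y) s₀ (20 * (n + 1) * L)
      (SubsetList (D.bag xi) (D.bag yi)) := by
  classical
  have h2n : 2 ^ (n + 1) = 2 * 2 ^ n := by ring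
  have hn0 : 0 < 2 ^ n := by positivity
  have hP : ∀ v, ((D.bag xi).filter fun u : Fin n => (u : ℕ) < v).card ≤ (D.bag xi).card :=
    fun v => card_le_card (filter_subset _ _)
  have hPL : ∀ v, 2 ^ ((D.bag xi).filter fun u : Fin n => (u : ℕ) < v).card ≤ L :=
    fun v => (Nat.pow_le_pow_right (by norm_num) (hP v)).trans hL
  have hPn : ∀ v, 2 ^ ((D.bag xi).filter fun u : Fin n => (u : ℕ) < v).card ≤ 2 ^ n :=
    fun v => Nat.pow_le_pow_right (by norm_num) ((hP v).trans (card_finset_fin_le _))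
  have hL1 : 1 ≤ L := le_trans Nat.one_le_two_pow hL
  refine Triple.mono (T := (n * (L * (4 + 4) + 3 + 2 + 4) + 3) + 2 + 2 + 2) (Q := fun s =>
    SubsetList (D.bag xi) (D.bag yi) s) ?_ (by nlinarith) fun _ _ h => h
  refine Triple.write_seq (by simp) (Triple.write_seq (by simp) (Triple.assign_seq ?_ ?_))
  · simp only [Expr.eval_const]; omega
  simp only [Expr.eval_const]
  set s₁ := ((s₀.setArr 4 0 0).setArr 5 0 0).setVar 14 1 with hs₁
  have hF₁ : Frame [14] [4, 5] s₀ s₁ := by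
    constructor
    · intro a ha; simp at ha; simp [hs₁, ha]
    · intro a ha; simp at ha; simp [hs₁, ha]
  have hE₁ : Env D root k r s₁ := hE.frame hF₁ (by simp) (by simp)
  have hx₁ : s₁.var x = xi := by rw [hF₁.1 x (by rcases hx' with rfl | rfl <;> simp), hx]
  have hy₁ : s₁.var y = yi := by rw [hF₁.1 y (by rcases hy' with rfl | rfl <;> simp), hy]
  have h14 : s₁.var 14 = 1 := by simp [hs₁]
  have h40 : s₁.arr 4 0 = 0 := by simp [hs₁]
  have h50 : s₁.arr 5 0 = 0 := by simp [hs₁]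
  clear_value s₁
  have hvars : (Program.seq (forTo 15 14 (.seq
      (.write 4 (.var 14 + .var 15) (.read 4 (.var 15) + .read 3 (.var 16)))
      (.write 5 (.var 14 + .var 15)
        (.read 5 (.var 15) + .read 3 (.var 16) * .read 2 (.var y * .var 0 + .var 16)))))
      (.assign 14 (.var 14 + .var 14 * .read 2 (.var x * .var 0 + .var 16)))).vars
      = [15, 15, 14] := rfl
  refine ((Triple.forLoop (T := L * (4 + 4) + 3 + 2) (fun v s =>
    s.var 14 = 2 ^ ((D.bag xi).filter fun u : Fin n => (u : ℕ) < v).card ∧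
    (∀ i < s.var 14, s.arr 4 i < 2 ^ v ∧ bits n (s.arr 4 i) ⊆ D.bag xi ∧ s.arr 5 i < 2 ^ v ∧
      bits n (s.arr 5 i) = bits n (s.arr 4 i) ∩ D.bag yi) ∧
    ∀ M < 2 ^ v, bits n M ⊆ D.bag xi → ∃ i < s.var 14, s.arr 4 i = M) ?_ ?_ ?_ ?_).mono ?_ ?_)
  · rw [hvars]; simp
  · rw [hvars]; simp
  · simp only [State.setVar_var, State.setVar_arr, h14]
    refine ⟨by simp, ?_, ?_⟩
    · intro i hi
      obtain rfl : i = 0 := by simpa using hi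
      simp [h40, h50, bits_zero]
    · intro M hM _
      exact ⟨0, by simp, by rw [h40]; rw [pow_zero] at hM; omega⟩
  · intro v s hv hsv hF ⟨hlen, hlist, hcomp⟩
    rw [hE₁.v0] at hv
    have hEs := hE₁.frame hF (by rw [hvars]; simp) (fun a ha => by
      simp [Program.arrs, forTo] at ha; omega)
    have hxs : s.var x = xi := by
      rw [hF.1 x (by rw [hvars]; rcases hx' with rfl | rfl <;> simp), hx₁]
    have hys : s.var y = yi := by
      rw [hF.1 y (by rw [hvars]; rcases hy' with rfl | rfl <;> simp), hy₁]
    have hvn : 2 ^ v * 2 ≤ 2 ^ n := by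
      rw [← pow_succ]; exact Nat.pow_le_pow_right (by norm_num) hv
    have hbx := hEs.bag xi ⟨v, hv⟩
    have hby := hEs.bag yi ⟨v, hv⟩
    simp only at hbx hby
    set len := s.var 14 with hlen'
    refine Triple.mono (T := len * (4 + 4) + 3 + 1 + 1) (Q := _) ?_ ?_ fun _ _ h => h
    · refine Triple.seq (T₁ := len * (4 + 4) + 3) (T₂ := 1) (Q₁ := fun s' => (∀ j < len, s'.arr 4 j = s.arr 4 j ∧
        s'.arr 5 j = s.arr 5 j) ∧ ∀ j < len, s'.arr 4 (len + j) = s.arr 4 j + 2 ^ v ∧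
        s'.arr 5 (len + j) = s.arr 5 j + 2 ^ v * if (⟨v, hv⟩ : Fin n) ∈ D.bag yi then 1 else 0)
        ?_ ?_
      · refine (Triple.forLoop (T := 4) (fun i s' => (∀ j < len, s'.arr 4 j = s.arr 4 j ∧
          s'.arr 5 j = s.arr 5 j) ∧ ∀ j < i, s'.arr 4 (len + j) = s.arr 4 j + 2 ^ v ∧
          s'.arr 5 (len + j) = s.arr 5 j +
            2 ^ v * if (⟨v, hv⟩ : Fin n) ∈ D.bag yi then 1 else 0) ?_ ?_ ?_ ?_).mono le_rfl
          fun _ _ h => h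
        · simp [Program.vars]
        · simp [Program.vars]
        · simp
        · intro i s' hi hsi hF' ⟨hI1, hI2⟩
          have hEs' := hEs.frame hF' (by simp [Program.vars]) (by simp [Program.arrs])
          have e14 : s'.var 14 = len := hF'.1 14 (by simp [Program.vars])
          have e16 : s'.var 16 = v := by rw [hF'.1 16 (by simp [Program.vars]), hsv]
          have ey : s'.var y = yi := by
            rw [hF'.1 y (by rcases hy' with rfl | rfl <;> simp [Program.vars]), hys]
          have e2 : s'.arr 2 = s.arr 2 := hF'.2 2 (by simp [Program.arrs])
          have e3 : s'.arr 3 v = 2 ^ v := hEs'.a3 v hv.le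
          have h1 := hlist i hi
          have h2 := hI1 i hi
          refine (Triple.write_seq ?_ (Triple.write ?_ ?_)).mono (by norm_num) fun _ _ h => h
          · simp only [Expr.eval_add, Expr.eval_read, Expr.eval_var, hsi, e16, e3, h2.1]
            omega
          · simp [hsi, e16, e3, h2.2, ey, e2, hEs'.v0, hby]
            split <;> omega
          · simp only [Expr.eval_add, Expr.eval_mul, Expr.eval_read, Expr.eval_var, hsi, e16, e3,
              e14, State.setArr_var, State.setArr_arr, State.setVar_arr, ey, e2, hEs'.v0, hby, h2.1,
              h2.2, reduceIte, Nat.reduceEqDiff]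
            constructor
            · intro j hj
              rw [Function.update_of_ne (by omega), Function.update_of_ne (by omega)]
              exact hI1 j hj
            · intro j hj
              by_cases hji : j = i
              · subst hji
                simp
              · rw [Function.update_of_ne (by omega), Function.update_of_ne (by omega)]
                exact hI2 j (by omega)
      · intro s' hF' ⟨hI1, hI2⟩
        have hEs' := hEs.frame hF' (fun a ha => by
          simp [Program.vars, forTo] at ha; omega)
          (fun a ha => by simp [Program.arrs, forTo] at ha; omega)
        have e14 : s'.var 14 = len :=
          hF'.1 14 (by simp [Program.vars, forTo])
        have e16 : s'.var 16 = v := by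
          rw [hF'.1 16 (by simp [Program.vars, forTo]), hsv]
        have ex : s'.var x = xi := by
          rw [hF'.1 x (by
            rcases hx' with rfl | rfl <;> simp [Program.vars, forTo]), hxs]
        have e2 : s'.arr 2 = s.arr 2 :=
          hF'.2 2 (by simp [Program.arrs, forTo])
        have hnew : (Expr.var 14 + .var 14 * .read 2 (.var x * .var 0 + .var 16)).eval s' =
            2 ^ ((D.bag xi).filter fun u : Fin n => (u : ℕ) < v + 1).card := by
          simp only [Expr.eval_add, Expr.eval_mul, Expr.eval_read, Expr.eval_var, e14, e16, ex, e2,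
            hEs'.v0, hbx]
          rw [filter_val_lt_succ _ hv]
          split
          · rw [card_insert_of_notMem (by simp), pow_succ, hlen]; ring
          · rw [hlen]; ring
        refine Triple.assign ?_ ?_
        · rw [hnew]
          have := hPn (v + 1)
          omega
        · rw [hnew]
          simp only [State.setVar_var, State.setVar_arr, reduceIte, Nat.reduceEqDiff]
          refine ⟨trivial, ?_, ?_⟩
          · intro i hi
            by_cases hil : i < len
            · rw [(hI1 i hil).1, (hI1 i hil).2]
              obtain ⟨a, b, c, d⟩ := hlist i hil
              rw [pow_succ]
              exact ⟨by omega, b, by omega, d⟩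
            -- An entry beyond the old length exists only if v is in the bag; it belongs to the
            -- shifted copy.
            · rw [filter_val_lt_succ _ hv] at hi
              split at hi
              · rename_i hvx
                rw [card_insert_of_notMem (by simp), pow_succ, ← hlen] at hi
                obtain ⟨j, rfl⟩ : ∃ j, i = len + j := Nat.exists_eq_add_of_le (by omega)
                obtain ⟨a, b, c, d⟩ := hlist j (by omega)
                obtain ⟨h4, h5⟩ := hI2 j (by omega)
                have b4 := bits_add_pow (notMem_bits_of_lt hv a)
                have b5 := bits_add_pow (notMem_bits_of_lt hv c)
                simp only at b4 b5
                rw [h4, h5, b4, pow_succ]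
                refine ⟨by omega, insert_subset hvx b, by split <;> omega, ?_⟩
                split
                · rename_i hvy
                  rw [mul_one, b5, d, insert_inter_of_mem hvy]
                · rename_i hvy
                  rw [mul_zero, add_zero, d, insert_inter_of_notMem hvy]
              · omega
          · intro M hM hMx
            by_cases hvM : (⟨v, hv⟩ : Fin n) ∈ bits n M
            · have h1 := bits_sub_pow hvM
              have h2 := pow_le_of_mem_bits hvM
              simp only at h1 h2
              rw [pow_succ] at hM
              obtain ⟨i, hi, hiM⟩ := hcomp (M - 2 ^ v) (by omega) (by
                rw [h1]; exact (erase_subset _ _).trans hMx)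
              refine ⟨len + i, ?_, ?_⟩
              · rw [filter_val_lt_succ _ hv, if_pos (hMx hvM), card_insert_of_notMem (by simp),
                  pow_succ, ← hlen]
                omega
              · rw [(hI2 i hi).1, hiM]
                omega
            · have hM' : M < 2 ^ v := by
                refine lt_two_pow_of_lt_succ hM ?_
                rw [mem_bits] at hvM
                simp only at hvM
                omega
              obtain ⟨i, hi, hiM⟩ := hcomp M hM' hMx
              refine ⟨i, hi.trans_le ?_, by rw [(hI1 i hi).1, hiM]⟩
              rw [hlen]
              exact Nat.pow_le_pow_right (by norm_num)
                (card_le_card (monotone_filter_right _ fun u _ hu => by omega))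
    · have := hPL v
      rw [← hlen] at this
      nlinarith
  · rw [hE₁.v0]
  · intro s' _ h
    rw [hE₁.v0, filter_val_lt_self] at h
    obtain ⟨h1, h2, h3⟩ := h
    exact ⟨h1, fun i hi => (h2 i hi).1, fun i hi => (h2 i hi).2.1, fun i hi => (h2 i hi).2.2.1,
      fun i hi => (h2 i hi).2.2.2, h3⟩

end Verification

end CliquePartition

namespace CliquePartition

/-! ### Bounds on the constants, and the inspection of a single subset -/

section Verification

variable {n N : ℕ} {G : SimpleGraph (Fin n)} {D : TreeDecomposition G (Fin N)} {root : Fin N}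
  {k r : ℕ} {W B : ℕ}

open Finset

theorem two_pow_le_modulus (n : ℕ) : 2 ^ (n + 1) ≤ modulus n := by
  rw [modulus_eq]
  simpa using two_pow_pow_le (n := n) (i := 1) (j := 4) (by norm_num)

theorem digitBase_le_modulus (n : ℕ) : digitBase n ≤ modulus n := by
  rw [modulus_eq, digitBase_eq]
  exact two_pow_pow_le (by norm_num)

theorem sizeBase_le_modulus (n : ℕ) : sizeBase n ≤ modulus n := by
  rw [modulus_eq, sizeBase_eq]
  exact two_pow_pow_le (by norm_num)

theorem sizeBase_pos (n : ℕ) : 0 < sizeBase n := by rw [sizeBase_eq]; positivity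

theorem digitBase_pos (n : ℕ) : 0 < digitBase n := by rw [digitBase_eq]; positivity

theorem modulus_pos (n : ℕ) : 0 < modulus n := by rw [modulus_eq]; positivity

theorem sizeBase_pow_le_modulus {n i : ℕ} (hi : i ≤ n + 1) : sizeBase n ^ i ≤ modulus n := by
  rw [modulus, ← pow_succ]
  exact Nat.pow_le_pow_right (sizeBase_pos n) hi

theorem lt_modulus (n : ℕ) : n + 1 < modulus n :=
  Nat.lt_two_pow_self.trans_le (two_pow_le_modulus n)

theorem forall_val_lt_succ {p : Fin n → Prop} {v : ℕ} (hv : v < n) :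
    (∀ u : Fin n, (u : ℕ) < v + 1 → p u) ↔ (∀ u : Fin n, (u : ℕ) < v → p u) ∧ p ⟨v, hv⟩ := by
  constructor
  · exact fun h => ⟨fun u hu => h u (by omega), h _ (by simp)⟩
  · rintro ⟨h1, h2⟩ u hu
    rcases Nat.lt_succ_iff_lt_or_eq.1 hu with h | h
    · exact h1 u h
    · rwa [show u = ⟨v, hv⟩ from Fin.ext h]

theorem ite_mul_ite_one (p q : Prop) [Decidable p] [Decidable q] :
    ((if p then 1 else 0) * if q then 1 else 0) = if p ∧ q then 1 else 0 := by
  split_ifs <;> simp_all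

open Classical in
theorem Triple.inspect {s₀ : State} {xi : Fin N} {M : ℕ}
    (hE : Env D root k r s₀) (hx : s₀.var 12 = xi) (hM : s₀.var 17 = M)
    (hB : modulus n ≤ 2 ^ B) :
    Triple W B Program.inspect s₀ (20 * (n + 1) ^ 2) fun s =>
      s.var 19 = (if G.IsClique (bits n M : Set (Fin n)) then 1 else 0) ∧
      s.var 20 = (bits n M).card ∧ s.var 21 = sizeBase n ^ (bits n M).card ∧
      s.var 22 = (bits n M \ D.bag xi).card := by
  have hn := lt_modulus n
  have hcard : ∀ S : Finset (Fin n), S.card ≤ n := fun S => card_finset_fin_le S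
  -- Being a clique is the conjunction of these conditions over all pairs; register 19 holds its
  -- truth value for the pairs seen so far, in lexicographic order.
  let pr : Fin n → Fin n → Prop := fun a b => a ∈ bits n M → b ∈ bits n M → a ≠ b → G.Adj a b
  refine Triple.mono (T := (n * ((n * (1 + 4) + 3) + 2 + 2 + 2 + 4) + 3) + 2 + 2 + 2 + 2) (Q := _)
    ?_ (by nlinarith) fun _ _ h => h
  refine Triple.assign_seq (by simp only [Expr.eval_const]; omega) (Triple.assign_seq (by simp)
    (Triple.assign_seq (by simp only [Expr.eval_const]; omega) (Triple.assign_seq (by simp) ?_)))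
  simp only [Expr.eval_const]
  set s₁ := (((s₀.setVar 19 1).setVar 20 0).setVar 21 1).setVar 22 0 with hs₁
  have hF₁ : Frame [19, 20, 21, 22] [] s₀ s₁ :=
    ⟨fun a ha => by simp at ha; simp [hs₁, ha], fun _ _ => rfl⟩
  have hE₁ : Env D root k r s₁ := hE.frame hF₁ (by simp) (by simp)
  have hx₁ : s₁.var 12 = xi := by rw [hF₁.1 _ (by simp), hx]
  have hM₁ : s₁.var 17 = M := by rw [hF₁.1 _ (by simp), hM]
  have h19 : s₁.var 19 = 1 := by simp [hs₁]
  have h20 : s₁.var 20 = 0 := by simp [hs₁]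
  have h21 : s₁.var 21 = 1 := by simp [hs₁]
  have h22 : s₁.var 22 = 0 := by simp [hs₁]
  clear_value s₁
  refine (Triple.forLoop (T := (n * (1 + 4) + 3) + 2 + 2 + 2) (fun u s =>
    s.var 19 = (if ∀ a : Fin n, (a : ℕ) < u → ∀ b, pr a b then 1 else 0) ∧
    s.var 20 = ((bits n M).filter fun a : Fin n => (a : ℕ) < u).card ∧
    s.var 21 = sizeBase n ^ ((bits n M).filter fun a : Fin n => (a : ℕ) < u).card ∧
    s.var 22 = ((bits n M \ D.bag xi).filter fun a : Fin n => (a : ℕ) < u).card)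
    ?_ ?_ ?_ ?_).mono ?_ ?_
  · simp [Program.vars, forTo]
  · simp [Program.vars, forTo]
  · simp [h19, h20, h21, h22]
  · intro u s hu hsu hF ⟨i19, i20, i21, i22⟩
    rw [hE₁.v0] at hu
    have hEs := hE₁.frame hF (fun a ha => by simp [Program.vars, forTo] at ha; omega)
      (by simp [Program.arrs, forTo])
    have hxs : s.var 12 = xi := by rw [hF.1 _ (by simp [Program.vars, forTo]), hx₁]
    have hMs : s.var 17 = M := by rw [hF.1 _ (by simp [Program.vars, forTo]), hM₁]
    have hbit := div_pow_mod_two M ⟨u, hu⟩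
    have hbag := hEs.bag xi ⟨u, hu⟩
    simp only at hbit hbag
    have e3 := hEs.a3 u hu.le
    have n20 : s.var 20 + s.var 17 / s.arr 3 (s.var 18) % 2 =
        ((bits n M).filter fun a : Fin n => (a : ℕ) < u + 1).card := by
      rw [hMs, hsu, e3, hbit, filter_val_lt_succ _ hu, i20]
      split
      · rw [card_insert_of_notMem (by simp)]
      · rw [add_zero]
    have n21 : s.var 21 * (s.var 17 / s.arr 3 (s.var 18) % 2 * s.var 8 +
        (1 - s.var 17 / s.arr 3 (s.var 18) % 2)) =
        sizeBase n ^ ((bits n M).filter fun a : Fin n => (a : ℕ) < u + 1).card := by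
      rw [hMs, hsu, e3, hbit, filter_val_lt_succ _ hu, i21, hEs.v8]
      split
      · rw [card_insert_of_notMem (by simp)]; ring
      · simp
    have n22 : s.var 22 + s.var 17 / s.arr 3 (s.var 18) % 2 *
        (1 - s.arr 2 (s.var 12 * s.var 0 + s.var 18)) =
        ((bits n M \ D.bag xi).filter fun a : Fin n => (a : ℕ) < u + 1).card := by
      rw [hMs, hsu, e3, hbit, filter_val_lt_succ _ hu, i22, hxs, hEs.v0, hbag]
      by_cases c1 : (⟨u, hu⟩ : Fin n) ∈ bits n M <;> by_cases c2 : (⟨u, hu⟩ : Fin n) ∈ D.bag xi <;>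
        simp [c1, c2]
    refine Triple.assign_seq ?_ (Triple.assign_seq ?_ (Triple.assign_seq ?_ ?_))
    · simp only [Expr.eval_add, Expr.eval_var, Expr.eval_bit, n20]
      have := hcard ((bits n M).filter fun a : Fin n => (a : ℕ) < u + 1)
      omega
    · simp only [Expr.eval_add, Expr.eval_sub, Expr.eval_const, Expr.eval_mul, Expr.eval_var,
        Expr.eval_bit, State.setVar_var, State.setVar_arr, reduceIte, Nat.reduceEqDiff, n21]
      have h1 : sizeBase n ^ ((bits n M).filter fun a : Fin n => (a : ℕ) < u + 1).card ≤
          sizeBase n ^ n := Nat.pow_le_pow_right (sizeBase_pos n) (hcard _)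
      have h2 : sizeBase n ^ n < 2 ^ B := by
        refine lt_of_lt_of_le ?_ hB
        rw [modulus, ← pow_succ]
        refine Nat.pow_lt_pow_right ?_ (by omega)
        rw [sizeBase_eq]
        exact Nat.one_lt_two_pow (by positivity)
      omega
    · simp only [Expr.eval_add, Expr.eval_sub, Expr.eval_const, Expr.eval_mul, Expr.eval_var,
        Expr.eval_bit, Expr.eval_read, State.setVar_var, State.setVar_arr, reduceIte,
        Nat.reduceEqDiff, n22]
      have := hcard ((bits n M \ D.bag xi).filter fun a : Fin n => (a : ℕ) < u + 1)
      omega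
    · simp only [Expr.eval_add, Expr.eval_sub, Expr.eval_const, Expr.eval_mul, Expr.eval_var,
        Expr.eval_bit, Expr.eval_read, State.setVar_var, State.setVar_arr, reduceIte,
        Nat.reduceEqDiff, n20, n21, n22]
      set s₂ := ((s.setVar 20 _).setVar 21 _).setVar 22 _ with hs₂
      have hF₂ : Frame [20, 21, 22] [] s s₂ :=
        ⟨fun a ha => by simp at ha; simp [hs₂, ha], fun _ _ => rfl⟩
      have hE₂ : Env D root k r s₂ := hEs.frame hF₂ (by simp) (by simp)
      have j17 : s₂.var 17 = M := by rw [hF₂.1 _ (by simp), hMs]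
      have j18 : s₂.var 18 = u := by rw [hF₂.1 _ (by simp), hsu]
      have j19 := hF₂.1 19 (by simp)
      have j20 : s₂.var 20 = ((bits n M).filter fun a : Fin n => (a : ℕ) < u + 1).card := by
        simp [hs₂]
      have j21 : s₂.var 21 =
          sizeBase n ^ ((bits n M).filter fun a : Fin n => (a : ℕ) < u + 1).card := by simp [hs₂]
      have j22 : s₂.var 22 =
          ((bits n M \ D.bag xi).filter fun a : Fin n => (a : ℕ) < u + 1).card := by simp [hs₂]
      rw [i19] at j19
      clear_value s₂
      refine (Triple.forLoop (T := 1) (fun w s => s.var 19 =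
        if (∀ a : Fin n, (a : ℕ) < u → ∀ b, pr a b) ∧
          ∀ b : Fin n, (b : ℕ) < w → pr ⟨u, hu⟩ b then 1 else 0) ?_ ?_ ?_ ?_).mono ?_ ?_
      · simp [Program.vars]
      · simp [Program.vars]
      · simp [j19]
      · intro w s' hw hsw hF' hI
        rw [hE₂.v0] at hw
        have hEs' := hE₂.frame hF' (by simp [Program.vars]) (by simp [Program.arrs])
        have e17 : s'.var 17 = M := by rw [hF'.1 _ (by simp [Program.vars]), j17]
        have e18 : s'.var 18 = u := by rw [hF'.1 _ (by simp [Program.vars]), j18]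
        have hbit' := div_pow_mod_two M ⟨w, hw⟩
        have hadj := hEs'.adj ⟨u, hu⟩ ⟨w, hw⟩
        simp only at hbit' hadj
        have hval : s'.var 19 * (1 - s'.var 17 / s'.arr 3 (s'.var 18) % 2 *
            (s'.var 17 / s'.arr 3 (s'.var 23) % 2 * ((1 - (Expr.bin .eq (.var 18) (.var 23)).eval s') *
              (1 - s'.arr 0 (s'.var 18 * s'.var 0 + s'.var 23))))) =
            if (∀ a : Fin n, (a : ℕ) < u → ∀ b, pr a b) ∧
              ∀ b : Fin n, (b : ℕ) < w + 1 → pr ⟨u, hu⟩ b then 1 else 0 := by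
          have h1 : 1 - s'.var 17 / s'.arr 3 (s'.var 18) % 2 *
            (s'.var 17 / s'.arr 3 (s'.var 23) % 2 * ((1 - (Expr.bin .eq (.var 18) (.var 23)).eval s') *
              (1 - s'.arr 0 (s'.var 18 * s'.var 0 + s'.var 23)))) =
              if pr ⟨u, hu⟩ ⟨w, hw⟩ then 1 else 0 := by
            rw [e17, e18, hsw, hEs'.a3 u hu.le, hEs'.a3 w hw.le, hbit, hbit', hEs'.v0, hadj, Expr.eval_eq, Expr.eval_var,
              Expr.eval_var, e18, hsw]
            by_cases c1 : (⟨u, hu⟩ : Fin n) ∈ bits n M <;>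
              by_cases c2 : (⟨w, hw⟩ : Fin n) ∈ bits n M <;> by_cases c3 : u = w <;>
                by_cases c4 : G.Adj ⟨u, hu⟩ ⟨w, hw⟩ <;> simp [pr, c1, c2, c3, c4]
          rw [h1, hI, forall_val_lt_succ hw, ← and_assoc, ite_mul_ite_one]
          congr
        refine Triple.assign ?_ ?_
        · simp only [Expr.eval_add, Expr.eval_sub, Expr.eval_const, Expr.eval_mul,
            Expr.eval_var, Expr.eval_bit, Expr.eval_read, hval]
          split <;> omega
        · simp only [Expr.eval_add, Expr.eval_sub, Expr.eval_const, Expr.eval_mul,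
            Expr.eval_var, Expr.eval_bit, Expr.eval_read, hval, State.setVar_var, reduceIte, Nat.reduceEqDiff]
      · rw [hE₂.v0]
      · intro s' hF' hI
        rw [hE₂.v0] at hI
        simp only [forall_val_lt_succ hu]
        refine ⟨?_, ?_, ?_, ?_⟩
        · rw [hI]
          simp
        · rw [hF'.1 _ (by simp [Program.vars, forTo]), j20]
        · rw [hF'.1 _ (by simp [Program.vars, forTo]), j21]
        · rw [hF'.1 _ (by simp [Program.vars, forTo]), j22]
  · rw [hE₁.v0]
  · rintro s' - ⟨i19, i20, i21, i22⟩
    rw [hE₁.v0] at i19 i20 i21 i22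
    rw [filter_val_lt_self] at i20 i21 i22
    refine ⟨?_, i20, i21, i22⟩
    rw [i19]
    congr 1
    rw [eq_iff_iff, SimpleGraph.IsClique, Set.Pairwise]
    constructor
    · exact fun h a ha b hb hab => h a a.2 b ha hb hab
    · exact fun h a _ b ha hb hab => h ha hb hab

end Verification

end CliquePartition

namespace CliquePartition

/-! ### Computing a message -/

section Verification

variable {n N : ℕ} {G : SimpleGraph (Fin n)} {D : TreeDecomposition G (Fin N)} {root : Fin N}
  {k r : ℕ} {W B : ℕ}

open Finset

/-- The stride exceeds every mask, so the windows of different layers, or of different nodes, are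
disjoint. Hence writing one layer does not disturb the previous one, which is still being read. -/
theorem layer_ne {n i j M M' : ℕ} (hij : i ≠ j) (hM : M < 2 ^ n) (hM' : M' < 2 ^ n) :
    i * 2 ^ (n + 1) + M ≠ j * 2 ^ (n + 1) + M' := by
  intro h
  have h2 : 2 ^ (n + 1) = 2 * 2 ^ n := by ring
  have h3 := congrArg (· / 2 ^ (n + 1)) h
  simp only [Nat.mul_comm _ (2 ^ (n + 1))] at h3
  rw [Nat.mul_add_div (by positivity), Nat.mul_add_div (by positivity),
    Nat.div_eq_of_lt (by omega), Nat.div_eq_of_lt (by omega)] at h3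
  omega

/-- The factor of a set in the generating function. -/
noncomputable def cliqueFactor (G : SimpleGraph (Fin n)) (r : ℕ) (C : Finset (Fin n)) :
    ZMod (modulus n) :=
  1 + (cliqueTerm G r (sizeBase n) (digitBase n) C : ℕ)

theorem Triple.write_cell {a c : ℕ} {i e : Expr} {s : State} {R : Type*} [CommRing R] {y : R}
    (hi : i.eval s = c) (hv : e.eval s < 2 ^ B) (hy : (e.eval s : R) = y) :
    Triple W B (.write a i e) s 1 fun s' => ∃ val : ℕ, (val : R) = y ∧
      s'.arr a = Function.update (s.arr a) c val :=
  Triple.write hv ⟨_, hy, by rw [State.setArr_arr, if_pos rfl, hi]⟩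

/-- A set lies inside the parent's bag exactly if register 22 is zero; the comparison with zero then
switches the clique term off. -/
theorem Triple.cliqueWeights {s₀ : State} {xi : Fin N} {Y : Finset (Fin n)} {L : ℕ}
    (hE : Env D root k r s₀) (hx : s₀.var 12 = xi) (hS : SubsetList Y (D.bag xi) s₀)
    (hB : modulus n ≤ 2 ^ B) (hL : 2 ^ Y.card ≤ L) :
    Triple W B Program.cliqueWeights s₀ (40 * (n + 1) ^ 2 * L) fun s =>
      ∀ M < 2 ^ n, bits n M ⊆ Y → (s.arr 6 M : ZMod (modulus n)) =
        if bits n M ⊆ D.bag xi then 1 else cliqueFactor G r (bits n M) := by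
  classical
  have h2n : 2 ^ n ≤ 2 ^ B :=
    (Nat.pow_le_pow_right (by norm_num) (by omega)).trans ((two_pow_le_modulus n).trans hB)
  have hL1 : 1 ≤ L := le_trans Nat.one_le_two_pow hL
  refine (Triple.forSubsets (a := 6) (base := 0) (T := 20 * (n + 1) ^ 2 + 1 + 1)
    (fun M => if bits n M ⊆ D.bag xi then 1 else cliqueFactor G r (bits n M)) hS h2n
    (by decide) (by decide) (by decide) ?_).mono (by
      have h1 : 1 ≤ (n + 1) ^ 2 := Nat.one_le_pow _ _ (by omega)
      have h2 := Nat.mul_le_mul_right (20 * (n + 1) ^ 2 + 1 + 1 + 6) hL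
      have h3 := Nat.mul_le_mul_right L h1
      nlinarith) fun s' _ h M hM hMY => by
      simpa using h.1 M hM hMY
  intro s j hj hs15 hs17 hlt hsub hF hout
  have hEs := hE.frame hF (by decide) (by decide)
  have hxs : s.var 12 = xi := by rw [hF.1 _ (by decide), hx]
  refine Triple.seq (Triple.inspect hEs hxs rfl hB) ?_
  rintro s' hF' ⟨h19, h20, h21, h22⟩
  have hEs' := hEs.frame hF' (by decide) (by decide)
  have e17 : s'.var 17 = s.var 17 := hF'.1 _ (by decide)
  have e6 : s'.arr 6 = s.arr 6 := hF'.2 _ (by decide)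
  rw [← e6]
  refine Triple.write_cell (by rw [Expr.eval_var, e17, zero_add]) ?_ ?_
  · rw [Expr.eval_mod, Expr.eval_var, hEs'.v10]
    exact (Nat.mod_lt _ (modulus_pos n)).trans_le hB
  · rw [Expr.eval_mod, Expr.eval_var, hEs'.v10, ZMod.natCast_mod]
    simp only [Expr.eval_add, Expr.eval_const, Expr.eval_mul, Expr.eval_var, Expr.eval_eq,
      Expr.eval_lt, h19, h20, h21, h22, hEs'.v3, hEs'.v7]
    by_cases c : bits n (s.var 17) ⊆ D.bag xi
    · simp [c, sdiff_eq_empty_iff_subset.2 c]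
    · have h : 0 < (bits n (s.var 17) \ D.bag xi).card :=
        card_pos.2 (nonempty_iff_ne_empty.2 fun h => c (sdiff_eq_empty_iff_subset.1 h))
      rw [if_neg c, if_pos h, cliqueFactor, cliqueTerm]
      split_ifs <;> simp

theorem Triple.subsetProducts {s₀ : State} {X Y : Finset (Fin n)} {L : ℕ}
    (hE : Env D root k r s₀) (hS : SubsetList Y X s₀)
    (hB : modulus n ≤ 2 ^ B) (hL : 2 ^ Y.card ≤ L) (f : Finset (Fin n) → ZMod (modulus n))
    (h₀ : ∀ M < 2 ^ n, bits n M ⊆ Y → (s₀.arr 6 M : ZMod (modulus n)) = f (bits n M)) :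
    Triple W B Program.subsetProducts s₀ (20 * (n + 1) * L) fun s =>
      ∀ M < 2 ^ n, bits n M ⊆ Y → (s.arr 6 (n * 2 ^ (n + 1) + M) : ZMod (modulus n)) =
        ∏ C ∈ (bits n M).powerset, f C := by
  classical
  have h2n : 2 ^ n ≤ 2 ^ B :=
    (Nat.pow_le_pow_right (by norm_num) (by omega)).trans ((two_pow_le_modulus n).trans hB)
  have hL1 : 1 ≤ L := le_trans Nat.one_le_two_pow hL
  refine (Triple.forLoop (T := 2 ^ Y.card * (1 + 6) + 3) (fun v s =>
    ∀ M < 2 ^ n, bits n M ⊆ Y → (s.arr 6 (v * 2 ^ (n + 1) + M) : ZMod (modulus n)) =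
      prodLayer f v (bits n M)) (by decide) (by decide) ?_ ?_).mono ?_ ?_
  · intro M hM hMY
    rw [State.setVar_arr, zero_mul, zero_add, h₀ M hM hMY, prodLayer_zero]
  · intro v s hv hsv hF hI
    rw [hE.v0] at hv
    have hS' := hS.frame hF (by decide) (by decide) (by decide)
    have hEs := hE.frame hF (by decide) (by decide)
    refine (Triple.forSubsets (a := 6) (base := (v + 1) * 2 ^ (n + 1)) (T := 1)
      (fun M => prodLayer f (v + 1) (bits n M)) hS' h2n
      (by decide) (by decide) (by decide) ?_).mono le_rfl fun s' _ h M hM hMY => by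
        simpa using h.1 M hM hMY
    intro s' j hj hs15 hs17 hlt hsub hF' hout
    have hEs' := hEs.frame hF' (by decide) (by decide)
    have e16 : s'.var 16 = v := by rw [hF'.1 _ (by decide), hsv]
    -- Layer v lies outside the window that is being written, so it can be read throughout the pass.
    have hold : ∀ M < 2 ^ n, bits n M ⊆ Y →
        (s'.arr 6 (v * 2 ^ (n + 1) + M) : ZMod (modulus n)) = prodLayer f v (bits n M) := by
      intro M hM hMY
      rw [hout _ fun M' hM' => layer_ne (by omega) hM hM', hI M hM hMY]
    refine Triple.write_cell (by simp only [Expr.eval_var, Expr.eval_add, Expr.eval_mul,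
      Expr.eval_const, e16, hEs'.v6]) ?_ ?_
    · rw [Expr.eval_mod, Expr.eval_var, hEs'.v10]
      exact (Nat.mod_lt _ (modulus_pos n)).trans_le hB
    · rw [Expr.eval_mod, Expr.eval_var, hEs'.v10, ZMod.natCast_mod]
      have hbit := div_pow_mod_two (s'.var 17) ⟨v, hv⟩
      simp only at hbit
      simp only [Expr.eval_add, Expr.eval_sub, Expr.eval_const, Expr.eval_mul, Expr.eval_var,
        Expr.eval_read, Expr.eval_bit, e16, hEs'.v6, hEs'.a3 v hv.le, hbit, Nat.cast_mul,
        Nat.cast_add, hold _ hlt hsub]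
      rw [prodLayer_succ f hv]
      split
      · rename_i h
        have h1 := bits_sub_pow h
        simp only at h1
        rw [hold _ ((Nat.sub_le _ _).trans_lt hlt) (by rw [h1]; exact (erase_subset _ _).trans hsub), h1]
        simp
      · simp
  · rw [hE.v0]; nlinarith
  · intro s' _ h M hM hMY
    rw [hE.v0] at h
    rw [h M hM hMY, prodLayer_card]

theorem Triple.tableProducts {s₀ : State} {yi : Fin N} {X Y : Finset (Fin n)} {L : ℕ}
    (hE : Env D root k r s₀) (hy : s₀.var 13 = yi) (hS : SubsetList Y X s₀)
    (hB : modulus n ≤ 2 ^ B) (hL : 2 ^ Y.card ≤ L) (f g : Finset (Fin n) → ZMod (modulus n))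
    (h₆ : ∀ M < 2 ^ n, bits n M ⊆ Y →
      (s₀.arr 6 (n * 2 ^ (n + 1) + M) : ZMod (modulus n)) = f (bits n M))
    (h₉ : ∀ M < 2 ^ n, bits n M ⊆ Y →
      (s₀.arr 9 (yi * 2 ^ (n + 1) + M) : ZMod (modulus n)) = g (bits n M)) :
    Triple W B Program.tableProducts s₀ (20 * L) fun s =>
      ∀ M < 2 ^ n, bits n M ⊆ Y →
        (s.arr 7 M : ZMod (modulus n)) = f (bits n M) * g (bits n M) := by
  have h2n : 2 ^ n ≤ 2 ^ B :=
    (Nat.pow_le_pow_right (by norm_num) (by omega)).trans ((two_pow_le_modulus n).trans hB)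
  have hL1 : 1 ≤ L := le_trans Nat.one_le_two_pow hL
  refine (Triple.forSubsets (a := 7) (base := 0) (T := 1)
    (fun M => f (bits n M) * g (bits n M)) hS h2n
    (by decide) (by decide) (by decide) ?_).mono (by omega) fun s' _ h M hM hMY => by
      simpa using h.1 M hM hMY
  intro s j hj hs15 hs17 hlt hsub hF hout
  have hEs := hE.frame hF (by decide) (by decide)
  have e13 : s.var 13 = yi := by rw [hF.1 _ (by decide), hy]
  have e6 : s.arr 6 = s₀.arr 6 := hF.2 _ (by decide)
  have e9 : s.arr 9 = s₀.arr 9 := hF.2 _ (by decide)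
  refine Triple.write_cell (by rw [Expr.eval_var, zero_add]) ?_ ?_
  · rw [Expr.eval_mod, Expr.eval_var, hEs.v10]
    exact (Nat.mod_lt _ (modulus_pos n)).trans_le hB
  · rw [Expr.eval_mod, Expr.eval_var, hEs.v10, ZMod.natCast_mod]
    simp only [Expr.eval_add, Expr.eval_mul, Expr.eval_var, Expr.eval_read, e13, hEs.v6, hEs.v0,
      e6, e9, Nat.cast_mul, h₆ _ hlt hsub, h₉ _ hlt hsub]

theorem Triple.sumOut {s₀ : State} {xi yi : Fin N} {L : ℕ}
    (hE : Env D root k r s₀) (hx : s₀.var 12 = xi) (hy : s₀.var 13 = yi)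
    (hS : SubsetList (D.bag yi) (D.bag xi) s₀)
    (hB : modulus n ≤ 2 ^ B) (hL : 2 ^ (D.bag yi).card ≤ L)
    (f : Finset (Fin n) → ZMod (modulus n))
    (h₀ : ∀ M < 2 ^ n, bits n M ⊆ D.bag yi → (s₀.arr 7 M : ZMod (modulus n)) = f (bits n M)) :
    Triple W B Program.sumOut s₀ (40 * (n + 1) * L) fun s =>
      ∀ M < 2 ^ n, bits n M ⊆ D.bag yi → (s.arr 7 (n * 2 ^ (n + 1) + M) : ZMod (modulus n)) =
        sumLayer (D.bag yi \ D.bag xi) f n (bits n M) := by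
  classical
  have h2n : 2 ^ n ≤ 2 ^ B :=
    (Nat.pow_le_pow_right (by norm_num) (by omega)).trans ((two_pow_le_modulus n).trans hB)
  have hL1 : 1 ≤ L := le_trans Nat.one_le_two_pow hL
  refine (Triple.forLoop (T := 2 ^ (D.bag yi).card * (1 + 2 + 6) + 3 + 2) (fun v s =>
    ∀ M < 2 ^ n, bits n M ⊆ D.bag yi → (s.arr 7 (v * 2 ^ (n + 1) + M) : ZMod (modulus n)) =
      sumLayer (D.bag yi \ D.bag xi) f v (bits n M)) (by decide) (by decide) ?_ ?_).mono ?_ ?_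
  · intro M hM hMY
    rw [State.setVar_arr, zero_mul, zero_add, h₀ M hM hMY, sumLayer_zero]
  · intro v s hv hsv hF hI
    rw [hE.v0] at hv
    have hEs := hE.frame hF (by decide) (by decide)
    have e12 : s.var 12 = xi := by rw [hF.1 _ (by decide), hx]
    have e13 : s.var 13 = yi := by rw [hF.1 _ (by decide), hy]
    have hbx := hEs.bag xi ⟨v, hv⟩
    have hby := hEs.bag yi ⟨v, hv⟩
    simp only at hbx hby
    have hflag : (Expr.read 2 (.var 13 * .var 0 + .var 16) *
        (.const 1 - .read 2 (.var 12 * .var 0 + .var 16))).eval s =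
        if (⟨v, hv⟩ : Fin n) ∈ D.bag yi \ D.bag xi then 1 else 0 := by
      simp only [Expr.eval_add, Expr.eval_sub, Expr.eval_const, Expr.eval_mul, Expr.eval_var,
        Expr.eval_read, e12, e13, hsv, hEs.v0, hbx, hby, mem_sdiff]
      split_ifs <;> simp_all
    refine Triple.assign_seq ?_ ?_
    · rw [hflag]
      have := lt_modulus n
      split <;> omega
    rw [hflag]
    set s₁ := s.setVar 24 _ with hs₁
    have hF₁ : Frame [24] [] s s₁ :=
      ⟨fun a ha => by simp at ha; simp [hs₁, ha], fun _ _ => rfl⟩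
    have hE₁ := hEs.frame hF₁ (by decide) (by decide)
    have hS₁ := (hS.frame hF (by decide) (by decide) (by decide)).frame hF₁ (by decide)
      (by decide) (by decide)
    have e24 : s₁.var 24 = if (⟨v, hv⟩ : Fin n) ∈ D.bag yi \ D.bag xi then 1 else 0 := by
      simp [hs₁]
    have e16 : s₁.var 16 = v := by rw [hF₁.1 _ (by decide), hsv]
    have hI₁ : s₁.arr 7 = s.arr 7 := rfl
    clear_value s₁
    refine (Triple.forSubsets (a := 7) (base := (v + 1) * 2 ^ (n + 1)) (T := 1 + 2)
      (fun M => sumLayer (D.bag yi \ D.bag xi) f (v + 1) (bits n M)) hS₁ h2n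
      (by decide) (by decide) (by decide) ?_).mono le_rfl fun s' _ h M hM hMY => by
        simpa using h.1 M hM hMY
    intro s' j hj hs15 hs17 hlt hsub hF' hout
    have hEs' := hE₁.frame hF' (by decide) (by decide)
    have f16 : s'.var 16 = v := by rw [hF'.1 _ (by decide), e16]
    have f24 := hF'.1 24 (by decide)
    rw [e24] at f24
    have hold : ∀ M < 2 ^ n, bits n M ⊆ D.bag yi →
        (s'.arr 7 (v * 2 ^ (n + 1) + M) : ZMod (modulus n)) =
          sumLayer (D.bag yi \ D.bag xi) f v (bits n M) := by
      intro M hM hMY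
      rw [hout _ fun M' hM' => layer_ne (by omega) hM hM', hI₁, hI M hM hMY]
    have hbit := div_pow_mod_two (s'.var 17) ⟨v, hv⟩
    simp only at hbit
    have he25 : (Expr.var 17 - .bit 17 16 * .read 3 (.var 16)).eval s' =
        s'.var 17 - (if (⟨v, hv⟩ : Fin n) ∈ bits n (s'.var 17) then 1 else 0) * 2 ^ v := by
      simp only [Expr.eval_sub, Expr.eval_mul, Expr.eval_var, Expr.eval_read, Expr.eval_bit, f16,
        hEs'.a3 v hv.le, hbit]
    set M₀ := s'.var 17 - (if (⟨v, hv⟩ : Fin n) ∈ bits n (s'.var 17) then 1 else 0) * 2 ^ v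
      with hM₀
    have hM₀lt : M₀ < 2 ^ n := (Nat.sub_le _ _).trans_lt hlt
    have hM₀bits : bits n M₀ = (bits n (s'.var 17)).erase ⟨v, hv⟩ := by
      rw [hM₀]
      split
      · rename_i h
        have := bits_sub_pow h
        simpa using this
      · rename_i h
        rw [zero_mul, Nat.sub_zero, erase_eq_of_notMem h]
    refine Triple.assign_seq (by rw [he25]; omega) (Triple.write_cell (by
      simp only [State.setVar_var, reduceIte, Expr.eval_var, Expr.eval_add, Expr.eval_mul,
        Expr.eval_const, f16, hEs'.v6, Nat.reduceEqDiff]) ?_ ?_)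
    · rw [Expr.eval_mod, Expr.eval_var, State.setVar_var, if_neg (by norm_num), hEs'.v10]
      exact (Nat.mod_lt _ (modulus_pos n)).trans_le hB
    · rw [Expr.eval_mod, Expr.eval_var, State.setVar_var, if_neg (by norm_num), hEs'.v10,
        ZMod.natCast_mod]
      -- The machine has no negative numbers: the factor `modulus n - 1` plays the role of -1.
      simp only [Expr.eval_add, Expr.eval_sub, Expr.eval_const, Expr.eval_mul, Expr.eval_var,
        Expr.eval_read, State.setVar_var, State.setVar_arr, reduceIte, Nat.reduceEqDiff, he25,
        f16, f24, hEs'.v6, hEs'.v10, hEs'.a3 v hv.le, Nat.cast_mul, Nat.cast_add,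
        hold _ hlt hsub, Nat.cast_sub (modulus_pos n : 1 ≤ modulus n), ZMod.natCast_self,
        hold M₀ hM₀lt (hM₀bits ▸ (erase_subset _ _).trans hsub)]
      rw [sumLayer_succ _ f hv]
      split
      · rename_i h
        have hv0 : (⟨v, hv⟩ : Fin n) ∉ bits n M₀ := by simp [hM₀bits]
        have h1 := bits_add_pow hv0
        have h2 := add_pow_lt_of_notMem_bits hM₀lt hv0
        simp only at h1 h2
        have h3 : insert ⟨v, hv⟩ ((bits n (s'.var 17)).erase ⟨v, hv⟩) =
            insert ⟨v, hv⟩ (bits n (s'.var 17)) := by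
          ext u
          by_cases hu : u = ⟨v, hv⟩ <;> simp [hu]
        rw [hM₀bits, h3] at h1
        -- Both table entries exist: v is in the child's bag, so adding it to a subset of that bag
        -- stays within the bag.
        rw [hold _ h2 (h1 ▸ insert_subset (mem_sdiff.1 h).1 hsub), h1, hM₀bits]
        simp
        ring
      · simp
  · rw [hE.v0]; nlinarith
  · intro s' _ h M hM hMY
    rw [hE.v0] at h
    rw [h M hM hMY]

/-- Nothing here requires `yi` to be a child of `xi`. The program computes the message for every
pair of nodes and discards it later if it is not wanted. -/
theorem Triple.sendMessage {s₀ : State} {xi yi : Fin N} {L : ℕ}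
    (hE : Env D root k r s₀) (hx : s₀.var 12 = xi) (hy : s₀.var 13 = yi)
    (hB : modulus n ≤ 2 ^ B) (hL : 2 ^ (D.bag yi).card ≤ L)
    (f : Finset (Fin n) → ZMod (modulus n))
    (h₉ : ∀ M < 2 ^ n, bits n M ⊆ D.bag yi →
      (s₀.arr 9 (yi * 2 ^ (n + 1) + M) : ZMod (modulus n)) = f (bits n M)) :
    Triple W B Program.sendMessage s₀ (150 * (n + 1) ^ 2 * L) fun s =>
      ∀ M < 2 ^ n, bits n M ⊆ D.bag xi ∩ D.bag yi →
        (s.arr 7 (n * 2 ^ (n + 1) + M) : ZMod (modulus n)) =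
          message (cliqueFactor G r) (D.bag xi) (D.bag yi) f (bits n M) := by
  classical
  have hL1 : 1 ≤ L := le_trans Nat.one_le_two_pow hL
  refine Triple.mono (T := 20 * (n + 1) * L + (40 * (n + 1) ^ 2 * L + (20 * (n + 1) * L +
    (20 * L + 40 * (n + 1) * L + 1) + 1) + 1) + 1) (Q := _) ?_ ?_ fun _ _ h => h
  · refine Triple.seq (Triple.listSubsets hE hy hx (by norm_num) (by norm_num)
      ((two_pow_le_modulus n).trans hB) hL) fun s₁ F₁ S₁ => ?_
    have E₁ := hE.frame F₁ (by decide) (by decide)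
    have x₁ : s₁.var 12 = xi := by rw [F₁.1 _ (by decide), hx]
    have y₁ : s₁.var 13 = yi := by rw [F₁.1 _ (by decide), hy]
    refine Triple.seq (Triple.cliqueWeights E₁ x₁ S₁ hB hL) fun s₂ F₂ h₂ => ?_
    have E₂ := E₁.frame F₂ (by decide) (by decide)
    have S₂ := S₁.frame F₂ (by decide) (by decide) (by decide)
    have y₂ : s₂.var 13 = yi := by rw [F₂.1 _ (by decide), y₁]
    refine Triple.seq (Triple.subsetProducts E₂ S₂ hB hL
      (fun C => if C ⊆ D.bag xi then 1 else cliqueFactor G r C) h₂) fun s₃ F₃ h₃ => ?_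
    have E₃ := E₂.frame F₃ (by decide) (by decide)
    have S₃ := S₂.frame F₃ (by decide) (by decide) (by decide)
    have x₃ : s₃.var 12 = xi := by rw [F₃.1 _ (by decide), F₂.1 _ (by decide), x₁]
    have y₃ : s₃.var 13 = yi := by rw [F₃.1 _ (by decide), y₂]
    have e9 : s₃.arr 9 = s₀.arr 9 := by
      rw [F₃.2 _ (by decide), F₂.2 _ (by decide), F₁.2 _ (by decide)]
    refine Triple.seq (Triple.tableProducts E₃ y₃ S₃ hB hL
      (fun S => ∏ C ∈ S.powerset, if C ⊆ D.bag xi then 1 else cliqueFactor G r C) f h₃ (by rwa [e9]))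
      fun s₄ F₄ h₄ => ?_
    have E₄ := E₃.frame F₄ (by decide) (by decide)
    have S₄ := S₃.frame F₄ (by decide) (by decide) (by decide)
    have x₄ : s₄.var 12 = xi := by rw [F₄.1 _ (by decide), x₃]
    have y₄ : s₄.var 13 = yi := by rw [F₄.1 _ (by decide), y₃]
    refine (Triple.sumOut E₄ x₄ y₄ S₄ hB hL (fun T => (∏ C ∈ T.powerset,
      if C ⊆ D.bag xi then 1 else cliqueFactor G r C) * f T) h₄).mono le_rfl
      fun s₅ _ h₅ M hM hMXY => ?_
    rw [h₅ M hM (hMXY.trans inter_subset_right),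
      sumLayer_card _ _ _ _ (hMXY.trans inter_subset_left)]
  · have : (n + 1) * L ≤ (n + 1) ^ 2 * L := Nat.mul_le_mul_right _ (by nlinarith)
    have : L ≤ (n + 1) ^ 2 * L := Nat.le_mul_of_pos_left _ (by positivity)
    nlinarith

end Verification

end CliquePartition

namespace CliquePartition

/-! ### Combining the messages at a node -/

section Verification

variable {n N : ℕ} {G : SimpleGraph (Fin n)} {D : TreeDecomposition G (Fin N)} {root : Fin N}
  {k r : ℕ} {W B : ℕ}

open Finset

/-- Array `9` stores the tables `F`. -/
def Tables (D : TreeDecomposition G (Fin N)) (F : Fin N → Finset (Fin n) → ZMod (modulus n))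
    (s : State) : Prop :=
  ∀ x : Fin N, ∀ M < 2 ^ n, bits n M ⊆ D.bag x →
    (s.arr 9 (x * 2 ^ (n + 1) + M) : ZMod (modulus n)) = F x (bits n M)

open Classical in
/-- The product of the messages to `x`, if the tables are `F`. -/
noncomputable def combine (D : TreeDecomposition G (Fin N)) (root : Fin N) (r : ℕ)
    (F : Fin N → Finset (Fin n) → ZMod (modulus n)) (x : Fin N) (S : Finset (Fin n)) :
    ZMod (modulus n) :=
  ∏ y, if D.IsChild root x y then
    message (cliqueFactor G r) (D.bag x) (D.bag y) (F y) (S ∩ D.bag y) else 1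

theorem combine_congr {F F' : Fin N → Finset (Fin n) → ZMod (modulus n)} {x : Fin N}
    (h : ∀ y, D.IsChild root x y → F y = F' y) : combine D root r F x = combine D root r F' x := by
  funext S
  refine prod_congr rfl fun y _ => ?_
  split
  · rw [h y ‹_›]
  · rfl

/-- The recursion is well-founded, since depths are below N: iterating `combine` from an arbitrary
start, the value at depth d is settled after N - d rounds. -/
theorem exists_eq_combine (D : TreeDecomposition G (Fin N)) (root : Fin N) (r : ℕ) :
    ∃ g : Fin N → Finset (Fin n) → ZMod (modulus n), ∀ x, g x = combine D root r g x := by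
  let F : ℕ → Fin N → Finset (Fin n) → ZMod (modulus n) := fun i =>
    Nat.rec (fun _ _ => 1) (fun _ f => combine D root r f) i
  refine ⟨fun x => F (N - D.tree.dist root x) x, fun x => ?_⟩
  have hx := D.dist_lt_card root x
  rw [Fintype.card_fin] at hx
  obtain ⟨d, hd⟩ := Nat.exists_eq_add_of_lt hx
  have h1 : N - D.tree.dist root x = d + 1 := by omega
  simp only [h1]
  refine combine_congr (F := F d) fun y hy => ?_
  have := hy.2
  have h2 : N - D.tree.dist root y = d := by omega
  rw [h2]

theorem prod_ite_val_lt_succ {M : Type*} [CommMonoid M] (f : Fin N → M) {y : ℕ} (hy : y < N) :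
    (∏ z : Fin N, if (z : ℕ) < y + 1 then f z else 1) =
      (∏ z : Fin N, if (z : ℕ) < y then f z else 1) * f ⟨y, hy⟩ := by
  rw [← prod_filter, ← prod_filter, filter_val_lt_succ _ hy, if_pos (mem_univ _),
    prod_insert (by simp), mul_comm]

/-- A message is defined on subsets of both bags, so it is read at the intersection mask from array
5. The entry of the parent-child matrix selects between the message and the factor 1. -/
theorem Triple.receiveMessage {s₀ : State} {xi yi : Fin N} {L : ℕ}
    (hE : Env D root k r s₀) (hx : s₀.var 12 = xi) (hy : s₀.var 13 = yi)
    (hS : SubsetList (D.bag xi) (D.bag yi) s₀)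
    (hB : modulus n ≤ 2 ^ B) (hL : 2 ^ (D.bag xi).card ≤ L)
    (f h : Finset (Fin n) → ZMod (modulus n)) [Decidable (D.IsChild root xi yi)]
    (h₇ : ∀ M < 2 ^ n, bits n M ⊆ D.bag xi ∩ D.bag yi →
      (s₀.arr 7 (n * 2 ^ (n + 1) + M) : ZMod (modulus n)) = h (bits n M))
    (h₈ : ∀ M < 2 ^ n, bits n M ⊆ D.bag xi →
      (s₀.arr 8 (yi * 2 ^ (n + 1) + M) : ZMod (modulus n)) = f (bits n M)) :
    Triple W B Program.receiveMessage s₀ (20 * L) fun s =>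
      ∀ M < 2 ^ n, bits n M ⊆ D.bag xi →
        (s.arr 8 ((yi + 1) * 2 ^ (n + 1) + M) : ZMod (modulus n)) =
          f (bits n M) * if D.IsChild root xi yi then h (bits n M ∩ D.bag yi) else 1 := by
  have h2n : 2 ^ n ≤ 2 ^ B :=
    (Nat.pow_le_pow_right (by norm_num) (by omega)).trans ((two_pow_le_modulus n).trans hB)
  have hL1 : 1 ≤ L := le_trans Nat.one_le_two_pow hL
  refine (Triple.forSubsets (a := 8) (base := (yi + 1) * 2 ^ (n + 1)) (T := 1)
    (fun M => f (bits n M) * if D.IsChild root xi yi then h (bits n M ∩ D.bag yi) else 1) hS h2n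
    (by decide) (by decide) (by decide) ?_).mono (by omega) fun s' _ h M hM hMY => h.1 M hM hMY
  intro s j hj hs15 hs17 hlt hsub hF hout
  have hEs := hE.frame hF (by decide) (by decide)
  have e12 : s.var 12 = xi := by rw [hF.1 _ (by decide), hx]
  have e13 : s.var 13 = yi := by rw [hF.1 _ (by decide), hy]
  have e5 : s.arr 5 = s₀.arr 5 := hF.2 _ (by decide)
  have e7 : s.arr 7 = s₀.arr 7 := hF.2 _ (by decide)
  have h5 := hS.inter j hj
  rw [← hs17] at h5
  have hc := hEs.child xi yi
  refine Triple.write_cell (by simp only [Expr.eval_var, Expr.eval_add, Expr.eval_mul,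
      Expr.eval_const, e13, hEs.v6]) ?_ ?_
  · rw [Expr.eval_mod, Expr.eval_var, hEs.v10]
    exact (Nat.mod_lt _ (modulus_pos n)).trans_le hB
  · rw [Expr.eval_mod, Expr.eval_var, hEs.v10, ZMod.natCast_mod]
    simp only [Expr.eval_add, Expr.eval_sub, Expr.eval_const, Expr.eval_mul, Expr.eval_var,
      Expr.eval_read, e12, e13, hEs.v6, hEs.v0, hEs.v1, e5, e7, hs15, hc, Nat.cast_mul,
      Nat.cast_add]
    rw [hout _ fun M' hM' => layer_ne (by omega) hlt hM', h₈ _ hlt hsub,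
      h₇ _ (hS.lt' j hj) (by rw [h5]; exact inter_subset_inter_right hsub), h5]
    congr 1
    split_ifs <;> simp

/-- All N nodes are tried as children, and layer y of array 8 holds the product over the nodes below
y. The tables of the children are not assumed correct; they are whatever array 9 holds at the time.
-/
theorem Triple.processNode {s₀ : State} {xi : Fin N} {L : ℕ}
    (hE : Env D root k r s₀) (hx : s₀.var 12 = xi)
    (hB : modulus n ≤ 2 ^ B) (hL : ∀ x, 2 ^ (D.bag x).card ≤ L)
    (F : Fin N → Finset (Fin n) → ZMod (modulus n)) (hT : Tables D F s₀) :
    Triple W B Program.processNode s₀ (200 * (N + 1) * ((n + 1) ^ 2 * L))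
      (Tables D (Function.update F xi (combine D root r F xi))) := by
  classical
  have hn := lt_modulus n
  have h2n : 2 ^ n ≤ 2 ^ B :=
    (Nat.pow_le_pow_right (by norm_num) (by omega)).trans ((two_pow_le_modulus n).trans hB)
  have hB' := (two_pow_le_modulus n).trans hB
  have hL1 : 1 ≤ L := le_trans Nat.one_le_two_pow (hL xi)
  refine Triple.mono (T := 20 * (n + 1) * L + ((2 ^ (D.bag xi).card * (1 + 6) + 3) +
    ((N * ((150 * (n + 1) ^ 2 * L + (20 * (n + 1) * L + 20 * L + 1) + 1) + 4) + 3) +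
    (20 * (n + 1) * L + (2 ^ (D.bag xi).card * (1 + 6) + 3) + 1) + 1) + 1) + 1)
    (Q := _) ?_ ?_ fun _ _ h => h
  · refine Triple.seq (Triple.listSubsets hE hx hx (by norm_num) (by norm_num) hB' (hL xi))
      fun s₁ F₁ S₁ => ?_
    have E₁ := hE.frame F₁ (by decide) (by decide)
    have x₁ : s₁.var 12 = xi := by rw [F₁.1 _ (by decide), hx]
    refine Triple.seq (Triple.forSubsets (a := 8) (base := 0) (T := 1)
      (fun _ => (1 : ZMod (modulus n))) S₁ h2n (by decide) (by decide) (by decide) ?_)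
      fun s₂ F₂ h₂ => ?_
    · intro s j hj hs15 hs17 hlt hsub hF hout
      exact Triple.write_cell (by rw [Expr.eval_var, zero_add])
        (by rw [Expr.eval_const]; omega) (by simp)
    have E₂ := E₁.frame F₂ (by decide) (by decide)
    have x₂ : s₂.var 12 = xi := by rw [F₂.1 _ (by decide), x₁]
    have a₂ : s₂.arr 9 = s₀.arr 9 := by rw [F₂.2 _ (by decide), F₁.2 _ (by decide)]
    let c : Finset (Fin n) → Fin N → ZMod (modulus n) := fun S y =>
      if D.IsChild root xi y then
        message (cliqueFactor G r) (D.bag xi) (D.bag y) (F y) (S ∩ D.bag y) else 1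
    refine Triple.seq (Q₁ := fun s => ∀ M < 2 ^ n, bits n M ⊆ D.bag xi →
      (s.arr 8 (N * 2 ^ (n + 1) + M) : ZMod (modulus n)) = ∏ z, c (bits n M) z) ?_ ?_
    · refine (Triple.forLoop (T := 150 * (n + 1) ^ 2 * L + (20 * (n + 1) * L + 20 * L + 1) + 1)
        (fun y s => ∀ M < 2 ^ n, bits n M ⊆ D.bag xi →
          (s.arr 8 (y * 2 ^ (n + 1) + M) : ZMod (modulus n)) =
            ∏ z : Fin N, if (z : ℕ) < y then c (bits n M) z else 1)
        (by decide) (by decide) ?_ ?_).mono ?_ ?_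
      · intro M hM hMx
        simpa using h₂.1 M hM hMx
      · intro y s hy hsy hF hI
        rw [E₂.v1] at hy
        have Es := E₂.frame hF (by decide) (by decide)
        have xs : s.var 12 = xi := by rw [hF.1 _ (by decide), x₂]
        have as : s.arr 9 = s₀.arr 9 := by rw [hF.2 _ (by decide), a₂]
        refine Triple.seq (Triple.sendMessage (yi := ⟨y, hy⟩) Es xs hsy hB (hL _) (F ⟨y, hy⟩)
          (by rw [as]; exact hT ⟨y, hy⟩)) fun s₃ F₃ h₃ => ?_
        have E₃ := Es.frame F₃ (by decide) (by decide)
        have x₃ : s₃.var 12 = xi := by rw [F₃.1 _ (by decide), xs]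
        have y₃ : s₃.var 13 = y := by rw [F₃.1 _ (by decide), hsy]
        have a₃ : s₃.arr 8 = s.arr 8 := F₃.2 _ (by decide)
        refine Triple.seq (Triple.listSubsets (yi := ⟨y, hy⟩) E₃ x₃ y₃ (by norm_num) (by norm_num)
          hB' (hL xi)) fun s₄ F₄ S₄ => ?_
        have E₄ := E₃.frame F₄ (by decide) (by decide)
        have x₄ : s₄.var 12 = xi := by rw [F₄.1 _ (by decide), x₃]
        have y₄ : s₄.var 13 = y := by rw [F₄.1 _ (by decide), y₃]
        have a₄ : s₄.arr 8 = s.arr 8 := by rw [F₄.2 _ (by decide), a₃]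
        have b₄ : s₄.arr 7 = s₃.arr 7 := F₄.2 _ (by decide)
        refine (Triple.receiveMessage (yi := ⟨y, hy⟩) E₄ x₄ y₄ S₄ hB (hL xi)
          (fun S => ∏ z : Fin N, if (z : ℕ) < y then c S z else 1)
          (message (cliqueFactor G r) (D.bag xi) (D.bag ⟨y, hy⟩) (F ⟨y, hy⟩))
          (by rw [b₄]; exact h₃) (by rw [a₄]; exact hI)).mono le_rfl fun s₅ _ h₅ M hM hMx => ?_
        rw [State.setVar_arr, prod_ite_val_lt_succ _ hy]
        exact h₅ M hM hMx
      · rw [E₂.v1]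
      · intro s' _ h M hM hMx
        rw [E₂.v1] at h
        rw [h M hM hMx]
        exact prod_congr rfl fun z _ => if_pos z.2
    intro s₃ F₃ h₃
    have E₃ := E₂.frame F₃ (by decide) (by decide)
    have x₃ : s₃.var 12 = xi := by rw [F₃.1 _ (by decide), x₂]
    have a₃ : s₃.arr 9 = s₀.arr 9 := by rw [F₃.2 _ (by decide), a₂]
    refine Triple.seq (Triple.listSubsets E₃ x₃ x₃ (by norm_num) (by norm_num) hB' (hL xi))
      fun s₄ F₄ S₄ => ?_
    have E₄ := E₃.frame F₄ (by decide) (by decide)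
    have x₄ : s₄.var 12 = xi := by rw [F₄.1 _ (by decide), x₃]
    have a₄ : s₄.arr 9 = s₀.arr 9 := by rw [F₄.2 _ (by decide), a₃]
    have b₄ : s₄.arr 8 = s₃.arr 8 := F₄.2 _ (by decide)
    refine (Triple.forSubsets (a := 9) (base := xi * 2 ^ (n + 1)) (T := 1)
      (fun M => combine D root r F xi (bits n M)) S₄ h2n (by decide) (by decide) (by decide)
      ?_).mono le_rfl ?_
    · intro s j hj hs15 hs17 hlt hsub hF hout
      have Es := E₄.frame hF (by decide) (by decide)
      have xs : s.var 12 = xi := by rw [hF.1 _ (by decide), x₄]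
      have bs : s.arr 8 = s₃.arr 8 := by rw [hF.2 _ (by decide), b₄]
      -- The value is copied without reduction, so its bound comes from the cell that is read.
      refine Triple.of_bounded fun hb => Triple.write_cell (by
        simp only [Expr.eval_var, Expr.eval_add, Expr.eval_mul, xs, Es.v6]) ?_ ?_
      · rw [Expr.eval_read]
        exact hb.2 _ _
      · simp only [Expr.eval_read, Expr.eval_var, Expr.eval_add, Expr.eval_mul, Es.v6, Es.v1, bs]
        exact h₃ _ hlt hsub
    · rintro s' - ⟨h1, h2⟩ x M hM hMx
      by_cases hxx : x = xi
      · subst hxx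
        rw [Function.update_self]
        exact h1 M hM hMx
      · rw [Function.update_of_ne hxx,
          h2 _ fun M' hM' => layer_ne (fun h => hxx (Fin.ext h)) hM hM', a₄]
        exact hT x M hM hMx
  · have h1 : (n + 1) * L ≤ (n + 1) ^ 2 * L := Nat.mul_le_mul_right _ (by nlinarith)
    have h2 : L ≤ (n + 1) ^ 2 * L := Nat.le_mul_of_pos_left _ (by positivity)
    have h3 := hL xi
    have h4 : N * ((150 * (n + 1) ^ 2 * L + (20 * (n + 1) * L + 20 * L + 1) + 1) + 4) ≤
        N * (200 * ((n + 1) ^ 2 * L)) := Nat.mul_le_mul_left _ (by nlinarith)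
    nlinarith

/-! ### The whole program -/

theorem Triple.powLoop {dst base lim : ℕ} {s₀ : State} (hd : dst ≠ 15) (hbase : base ≠ 15)
    (hbd : base ≠ dst) (hl : lim ≠ 15) (hld : lim ≠ dst) (h1 : s₀.var dst = 1)
    (hpos : 0 < s₀.var base) (hB : s₀.var base ^ s₀.var lim < 2 ^ B) :
    Triple W B (forTo 15 lim (.assign dst (.var dst * .var base))) s₀ (s₀.var lim * (1 + 4) + 3)
      fun s => s.var dst = s₀.var base ^ s₀.var lim := by
  refine Triple.forLoop (T := 1) (fun i s => s.var dst = s₀.var base ^ i)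
    (by simp [Program.vars, hl, hld]) (by simp [Program.vars, hd.symm]) ?_ ?_
  · simp [State.setVar_var, hd, h1]
  · intro i s hi hsi hF hI
    have e := hF.1 base (by simp [Program.vars, hbase, hbd])
    have hval : (Expr.var dst * .var base).eval s = s₀.var base ^ (i + 1) := by
      rw [Expr.eval_mul, Expr.eval_var, Expr.eval_var, hI, e, pow_succ]
    refine Triple.assign ?_ ?_
    · rw [hval]
      exact (Nat.pow_le_pow_right hpos hi).trans_lt hB
    · rw [hval]
      simp [State.setVar_var, hd]

theorem Triple.setup (hB : modulus n < 2 ^ B) :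
    Triple W B Program.setup (inputState D root k r) (100 * (n + 1)) fun s =>
      Env D root k r s ∧ ∀ i, s.arr 9 i = 0 := by
  have hn := lt_modulus n
  have h2 := two_pow_le_modulus n
  have hz := digitBase_le_modulus n
  have hs := sizeBase_le_modulus n
  have hs' := sizeBase_pow_le_modulus (n := n) (i := n) (by omega)
  refine Triple.mono (T := ((((n + 1) * (1 + 2 + 4) + 3) + ((((n + 1) * (1 + 4) + 3) +
    ((((n + 1) * (1 + 4) + 3) + (((n * (1 + 4) + 3) + 1 + 1) + 2) + 1) + 2) + 1) + 2) + 1) + 2) + 2)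
    (Q := _) ?_ (by omega) fun _ _ h => h
  refine Triple.assign_seq (by simp [inputState]; omega) (Triple.assign_seq
    (by simp only [Expr.eval_const]; omega) ?_)
  set s₁ := ((inputState D root k r).setVar 5 _).setVar 6 _ with hs₁
  have v5 : s₁.var 5 = n + 1 := by simp [hs₁, inputState]
  have v6 : s₁.var 6 = 1 := by simp [hs₁]
  have F₁ : Frame [5, 6] [] (inputState D root k r) s₁ :=
    ⟨fun a ha => by simp at ha; simp [hs₁, ha], fun _ _ => rfl⟩
  clear_value s₁
  refine Triple.seq (Q₁ := fun s => s.var 6 = 2 ^ (n + 1) ∧ ∀ v < n + 1, s.arr 3 v = 2 ^ v) ?_ ?_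
  · refine (Triple.forLoop (T := 1 + 2) (fun i s => s.var 6 = 2 ^ i ∧ ∀ v < i, s.arr 3 v = 2 ^ v)
      (by decide) (by decide) ?_ ?_).mono ?_ ?_
    · simp [v6]
    · rintro i s hi hsi hF ⟨h6, h3⟩
      rw [v5] at hi
      have hi2 : 2 ^ i * 2 ≤ 2 ^ (n + 1) := by
        rw [← pow_succ]; exact Nat.pow_le_pow_right (by norm_num) hi
      refine Triple.write_seq (by rw [Expr.eval_var, h6]; omega) (Triple.assign ?_ ?_)
      · simp only [Expr.eval_mul, Expr.eval_var, Expr.eval_const, State.setArr_var, h6]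
        omega
      · simp only [Expr.eval_mul, Expr.eval_var, Expr.eval_const, State.setArr_var, h6,
          State.setVar_var, State.setVar_arr, State.setArr_arr, reduceIte, Nat.reduceEqDiff, hsi]
        refine ⟨by ring, fun v hv => ?_⟩
        rw [Function.update_apply]
        split
        · rename_i h; rw [h]
        · exact h3 v (by omega)
    · rw [v5]
    · intro s' _ h
      rwa [v5] at h
  rintro s₂ F₂ ⟨w6, w3⟩
  have w5 : s₂.var 5 = n + 1 := by rw [F₂.1 _ (by decide), v5]
  refine Triple.assign_seq (by simp only [Expr.eval_const]; omega) ?_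
  set s₃ := s₂.setVar 7 _ with hs₃
  have F₃ : Frame [7] [] s₂ s₃ := ⟨fun a ha => by simp at ha; simp [hs₃, ha], fun _ _ => rfl⟩
  have x7 : s₃.var 7 = 1 := by simp [hs₃]
  have x5 : s₃.var 5 = n + 1 := by rw [F₃.1 _ (by decide), w5]
  have x6 : s₃.var 6 = 2 ^ (n + 1) := by rw [F₃.1 _ (by decide), w6]
  clear_value s₃
  refine Triple.seq ((Triple.powLoop (by decide) (by decide) (by decide) (by decide) (by decide)
    x7 (by rw [x6]; positivity) (by rw [x5, x6]; exact hz.trans_lt hB)).mono (by rw [x5])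
    fun _ _ h => h) fun s₄ F₄ h₄ => ?_
  rw [x5, x6] at h₄
  have y5 : s₄.var 5 = n + 1 := by rw [F₄.1 _ (by decide), x5]
  refine Triple.assign_seq (by simp only [Expr.eval_const]; omega) ?_
  set s₅ := s₄.setVar 8 _ with hs₅
  have F₅ : Frame [8] [] s₄ s₅ := ⟨fun a ha => by simp at ha; simp [hs₅, ha], fun _ _ => rfl⟩
  have z8 : s₅.var 8 = 1 := by simp [hs₅]
  have z5 : s₅.var 5 = n + 1 := by rw [F₅.1 _ (by decide), y5]
  have z7 : s₅.var 7 = digitBase n := by rw [F₅.1 _ (by decide), h₄, digitBase]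
  clear_value s₅
  refine Triple.seq ((Triple.powLoop (by decide) (by decide) (by decide) (by decide) (by decide)
    z8 (by rw [z7]; exact digitBase_pos n) (by rw [z5, z7]; exact hs.trans_lt hB)).mono
    (by rw [z5]) fun _ _ h => h) fun s₆ F₆ h₆ => ?_
  rw [z5, z7] at h₆
  have u0 : s₆.var 0 = n := by
    rw [F₆.1 _ (by decide), F₅.1 _ (by decide), F₄.1 _ (by decide), F₃.1 _ (by decide),
      F₂.1 _ (by decide), F₁.1 _ (by decide)]
    rfl
  refine Triple.assign_seq (by simp only [Expr.eval_const]; omega) ?_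
  set s₇ := s₆.setVar 9 _ with hs₇
  have F₇ : Frame [9] [] s₆ s₇ := ⟨fun a ha => by simp at ha; simp [hs₇, ha], fun _ _ => rfl⟩
  have t9 : s₇.var 9 = 1 := by simp [hs₇]
  have t0 : s₇.var 0 = n := by rw [F₇.1 _ (by decide), u0]
  have t8 : s₇.var 8 = sizeBase n := by rw [F₇.1 _ (by decide), h₆, sizeBase]
  clear_value s₇
  refine Triple.seq (T₁ := n * (1 + 4) + 3) (T₂ := 1)
    ((Triple.powLoop (by decide) (by decide) (by decide) (by decide) (by decide)
    t9 (by rw [t8]; exact sizeBase_pos n) (by rw [t0, t8]; exact hs'.trans_lt hB)).mono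
    (by rw [t0]) fun _ _ h => h) fun s₈ F₈ h₈ => ?_
  rw [t0, t8] at h₈
  have hval : (Expr.var 9 * .var 8).eval s₈ = modulus n := by
    rw [Expr.eval_mul, Expr.eval_var, Expr.eval_var, h₈, F₈.1 8 (by decide), t8, modulus]
  refine Triple.assign (by rw [hval]; exact hB) ?_
  rw [hval]
  have hv : ∀ x, x ≤ 4 → (s₈.setVar 10 (modulus n)).var x = (inputState D root k r).var x := by
    intro x hx
    rw [State.setVar_var, if_neg (by omega), F₈.1, F₇.1, F₆.1, F₅.1, F₄.1, F₃.1, F₂.1, F₁.1] <;>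
      · simp [forTo, Program.vars]
        try omega
  have ha : ∀ a, a ≠ 3 → (s₈.setVar 10 (modulus n)).arr a = (inputState D root k r).arr a := by
    intro a ha
    rw [State.setVar_arr, F₈.2, F₇.2, F₆.2, F₅.2, F₄.2, F₃.2, F₂.2, F₁.2] <;>
      simp [forTo, Program.arrs, ha]
  refine ⟨⟨hv 0 (by norm_num), hv 1 (by norm_num), hv 2 (by norm_num), hv 3 (by norm_num),
    hv 4 (by norm_num), ?_, ?_, ?_, ?_, ?_, by simp, ha 0 (by norm_num), ha 1 (by norm_num),
    ha 2 (by norm_num), ?_⟩, fun i => by rw [ha 9 (by norm_num)]; rfl⟩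
  · rw [State.setVar_var, if_neg (by norm_num), F₈.1 _ (by decide), F₇.1 _ (by decide),
      F₆.1 _ (by decide), z5]
  · rw [State.setVar_var, if_neg (by norm_num), F₈.1 _ (by decide), F₇.1 _ (by decide),
      F₆.1 _ (by decide), F₅.1 _ (by decide), F₄.1 _ (by decide), x6]
  · rw [State.setVar_var, if_neg (by norm_num), F₈.1 _ (by decide), F₇.1 _ (by decide),
      F₆.1 _ (by decide), z7]
  · rw [State.setVar_var, if_neg (by norm_num), F₈.1 _ (by decide), t8]
  · rw [State.setVar_var, if_neg (by norm_num), h₈]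
  · intro v hv
    rw [State.setVar_arr, F₈.2 _ (by decide), F₇.2 _ (by decide), F₆.2 _ (by decide),
      F₅.2 _ (by decide), F₄.2 _ (by decide), F₃.2 _ (by decide), w3 v (by omega)]

/-- No bottom-up order of the nodes is computed. Instead all nodes are processed N times in
arbitrary order: after i rounds the tables at depth at least N - i are correct, and reprocessing
such a node reproduces its table because its children are correct too. -/
theorem Triple.processTree {s₀ : State} {L : ℕ} (hE : Env D root k r s₀)
    (hB : modulus n ≤ 2 ^ B) (hL : ∀ x, 2 ^ (D.bag x).card ≤ L)
    (F₀ g : Fin N → Finset (Fin n) → ZMod (modulus n)) (hT : Tables D F₀ s₀)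
    (hg : ∀ x, g x = combine D root r g x) :
    Triple W B (forTo 11 1 (forTo 12 1 Program.processNode)) s₀
      (N * ((N * (200 * (N + 1) * ((n + 1) ^ 2 * L) + 4) + 3) + 4) + 3) (Tables D g) := by
  have hdist : ∀ x, D.tree.dist root x < N := fun x => by simpa using D.dist_lt_card root x
  refine (Triple.forLoop (T := N * (200 * (N + 1) * ((n + 1) ^ 2 * L) + 4) + 3)
    (fun i s => ∃ F, Tables D F s ∧ ∀ x, N ≤ D.tree.dist root x + i → F x = g x)
    (by decide) (by decide) ?_ ?_).mono ?_ ?_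
  · refine ⟨F₀, hT, fun x hx => ?_⟩
    have := hdist x
    omega
  · rintro i s hi hsi hF ⟨F, hFT, hFg⟩
    have Es := hE.frame hF (by decide) (by decide)
    refine (Triple.forLoop (T := 200 * (N + 1) * ((n + 1) ^ 2 * L))
      (fun j s => ∃ F, Tables D F s ∧ (∀ x, N ≤ D.tree.dist root x + i → F x = g x) ∧
        ∀ x : Fin N, (x : ℕ) < j → N ≤ D.tree.dist root x + (i + 1) → F x = g x)
      (by decide) (by decide) ?_ ?_).mono ?_ ?_
    · exact ⟨F, hFT, hFg, fun x hx => absurd hx (by omega)⟩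
    · rintro j s' hj hsj hF' ⟨F', hFT', h1, h2⟩
      rw [Es.v1] at hj
      have Es' := Es.frame hF' (by decide) (by decide)
      refine (Triple.processNode (xi := ⟨j, hj⟩) Es' hsj hB hL F' hFT').mono le_rfl
        fun s'' _ h => ⟨_, h, ?_⟩
      have hnew : N ≤ D.tree.dist root ⟨j, hj⟩ + (i + 1) →
          combine D root r F' ⟨j, hj⟩ = g ⟨j, hj⟩ := by
        intro hN
        rw [hg ⟨j, hj⟩]
        refine combine_congr fun y hy => h1 y ?_
        have := hy.2
        omega
      constructor
      · intro x hx
        by_cases hxj : x = ⟨j, hj⟩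
        · subst hxj
          rw [Function.update_self]
          exact hnew (by omega)
        · rw [Function.update_of_ne hxj]
          exact h1 x hx
      · intro x hx hd
        by_cases hxj : x = ⟨j, hj⟩
        · subst hxj
          rw [Function.update_self]
          exact hnew hd
        · rw [Function.update_of_ne hxj]
          refine h2 x ?_ hd
          have : (x : ℕ) ≠ j := fun h => hxj (Fin.ext h)
          omega
    · rw [Es.v1]
    · rintro s' - ⟨F', hFT', -, h2⟩
      rw [Es.v1] at h2
      exact ⟨F', hFT', fun x hx => h2 x x.2 hx⟩
  · rw [hE.v1]
  · rintro s' - ⟨F, hFT, hFg⟩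
    rw [hE.v1] at hFg
    rwa [show F = g from funext fun x => hFg x (by omega)] at hFT

/-- Elimination and inclusion-exclusion meet here. The empty set has factor 1 because r ≥ 2, and a
set with a factor other than 1 is a clique, whose vertices share bags pairwise: adjacent ones by the
edge condition, and a vertex with itself by the covering condition. -/
theorem root_table (hbag : D.bag root = ∅) (hr : 2 ≤ r)
    {g : Fin N → Finset (Fin n) → ZMod (modulus n)} (hg : ∀ x, g x = combine D root r g x) :
    g root ∅ = ((∑ F : Finset (Finset (Fin n)), if F.sup id = univ then
      ∏ C ∈ F, cliqueTerm G r (sizeBase n) (digitBase n) C else 0 : ℕ) : ZMod (modulus n)) := by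
  classical
  have h := sum_eq_root D.bag (D.IsChild root) (D.tree.dist root) root (cliqueFactor G r) g
    (fun y hy => D.exists_isChild root hy) (fun x x' y h h' => h.parent_unique h')
    (fun x y h => h.2) (fun x y q h hq hd v hy hv => h.bag_inter_subset hq hd hy hv) hbag
    D.exists_mem_bag ?_ ?_ (fun x S => by
      rw [hg x, combine])
  · rw [← h]
    simp only [cliqueFactor]
    rw [sum_prod_powerset_eq_sum_cover]
    push_cast
    rfl
  · rw [cliqueFactor, cliqueTerm]
    rw [card_empty, if_neg (by omega : ¬ 0 = r), if_neg (by omega : ¬ 0 + 1 = r)]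
    simp
  · intro C hC u hu v hv
    have hcl : G.IsClique (C : Set (Fin n)) := by
      by_contra hcl
      exact hC (by rw [cliqueFactor, cliqueTerm, if_neg hcl]; simp)
    by_cases huv : u = v
    · subst huv
      obtain ⟨x, hx⟩ := D.exists_mem_bag u
      exact ⟨x, hx, hx⟩
    · exact D.exists_edge_bag u v (hcl hu hv huv)

theorem Triple.extract {s₀ : State} (hE : Env D root k r s₀) (hr : 2 ≤ r)
    (hB : modulus n ≤ 2 ^ B)
    (hT : (s₀.arr 9 (root * 2 ^ (n + 1)) : ZMod (modulus n)) =
      ((∑ F : Finset (Finset (Fin n)), if F.sup id = univ then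
        ∏ C ∈ F, cliqueTerm G r (sizeBase n) (digitBase n) C else 0 : ℕ) : ZMod (modulus n))) :
    Triple W B Program.extract s₀ (20 * (n + 1)) fun s =>
      s.var 0 = cliquePartitionCount G k r := by
  obtain ⟨K, hK⟩ := sum_cover_cliqueTerm G r hr (sizeBase n) (digitBase n)
  rw [hK] at hT
  have hp : ∀ i, cliquePartitionCount G i r < digitBase n := fun i => count_lt_digitBase G i r
  set p : ℕ → ℕ := fun i => cliquePartitionCount G i r with hpdef
  have hY : ∑ i ∈ range (n + 1), p i * digitBase n ^ i < sizeBase n := sum_digits_lt hp (n + 1)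
  have hzm := digitBase_le_modulus n
  have hsm := sizeBase_le_modulus n
  -- The multiple of b^(n+1) disappears modulo `modulus n`. The rest is b^n times a number below b
  -- and so is not altered by the reduction.
  have hmod : s₀.arr 9 (root * 2 ^ (n + 1)) % modulus n / sizeBase n ^ n =
      ∑ i ∈ range (n + 1), p i * digitBase n ^ i := by
    rw [ZMod.natCast_eq_natCast_iff] at hT
    rw [hT, pow_succ, ← modulus, Nat.add_mul_mod_self_left, Nat.mod_eq_of_lt,
      Nat.mul_div_cancel_left _ (pow_pos (sizeBase_pos n) n)]
    exact Nat.mul_lt_mul_of_pos_left hY (pow_pos (sizeBase_pos n) n)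
  have hm := modulus_pos n
  refine Triple.mono (T := (((n + 1) * ((1 + 2) + 4) + 3) + 1 + 1) + 2 + 2) (Q := _) ?_ (by omega)
    fun _ _ h => h
  have hval : (Expr.read 9 (.var 4 * .var 6) % .var 10 / .var 9).eval s₀ =
      ∑ i ∈ range (n + 1), p i * digitBase n ^ i := by
    simp only [Expr.eval_read, Expr.eval_mul, Expr.eval_mod, Expr.eval_div, Expr.eval_var, hE.v4,
      hE.v6, hE.v9, hE.v10, hmod]
  refine Triple.assign_seq (by rw [hval]; omega) (Triple.assign_seq
    (by simp only [Expr.eval_const]; omega) ?_)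
  rw [hval]
  set s₁ := (s₀.setVar 24 _).setVar 25 _ with hs₁
  have F₁ : Frame [24, 25] [] s₀ s₁ :=
    ⟨fun a ha => by simp at ha; simp [hs₁, ha], fun _ _ => rfl⟩
  have E₁ := hE.frame F₁ (by decide) (by decide)
  have v24 : s₁.var 24 = ∑ i ∈ range (n + 1), p i * digitBase n ^ i := by simp [hs₁]
  have v25 : s₁.var 25 = 0 := by simp [hs₁]
  clear_value s₁
  refine Triple.seq (T₁ := (n + 1) * ((1 + 2) + 4) + 3) (T₂ := 1) (Q₁ := fun s => s.var 25 = p k) ?_ ?_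
  -- Each round strips the lowest base-z digit; the digit of index k is added to register 25 when it
  -- comes by.
  · refine (Triple.forLoop (T := 1 + 2) (fun j s =>
      s.var 24 = ∑ i ∈ range (n + 1 - j), p (i + j) * digitBase n ^ i ∧
      s.var 24 < sizeBase n ∧ s.var 25 = if k < j then p k else 0)
      (by decide) (by decide) ?_ ?_).mono ?_ ?_
    · simp only [State.setVar_var, reduceIte, Nat.reduceEqDiff, v24, v25]
      exact ⟨by simp, hY, by simp⟩
    · rintro j s hj hsj hF ⟨h24, hlt, h25⟩
      have Es := E₁.frame hF (by decide) (by decide)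
      rw [E₁.v5] at hj
      obtain ⟨d, hd⟩ := Nat.exists_eq_add_of_lt hj
      have hd1 : n + 1 - j = d + 1 := by omega
      have hd2 : n + 1 - (j + 1) = d := by omega
      rw [hd1, sum_digits_succ (fun i => p (i + j)), zero_add] at h24
      have hmodz : s.var 24 % digitBase n = p j := by
        rw [h24, Nat.add_mul_mod_self_left, Nat.mod_eq_of_lt (hp j)]
      have hdivz : s.var 24 / digitBase n =
          ∑ i ∈ range d, p (i + (j + 1)) * digitBase n ^ i := by
        rw [h24, Nat.add_mul_div_left _ _ (digitBase_pos n), Nat.div_eq_of_lt (hp j), zero_add]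
        exact sum_congr rfl fun i _ => by rw [add_right_comm, ← add_assoc]
      have hv25 : (Expr.var 25 + .bin .eq (.var 15) (.var 2) * (.var 24 % .var 7)).eval s =
          if k < j + 1 then p k else 0 := by
        simp only [Expr.eval_add, Expr.eval_mul, Expr.eval_mod, Expr.eval_eq, Expr.eval_var, hsj,
          Es.v2, Es.v7, hmodz, h25]
        rcases lt_trichotomy k j with h | h | h
        · rw [if_pos h, if_neg (by omega), if_pos (by omega)]; ring
        · subst h
          simp
        · rw [if_neg (by omega), if_neg (by omega), if_neg (by omega)]; ring
      refine Triple.assign_seq ?_ (Triple.assign ?_ ?_)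
      · rw [hv25]
        have := hp k
        simp only [hpdef]
        split <;> omega
      · simp only [Expr.eval_div, Expr.eval_var, State.setVar_var, reduceIte, Nat.reduceEqDiff]
        have := Nat.div_le_self (s.var 24) (s.var 7)
        omega
      · simp only [Expr.eval_div, Expr.eval_var, State.setVar_var, reduceIte, Nat.reduceEqDiff,
          hv25, Es.v7, hdivz, hd2]
        refine ⟨trivial, ?_, trivial⟩
        rw [← hdivz]
        exact (Nat.div_le_self _ _).trans_lt hlt
    · rw [E₁.v5]
    · rintro s' - ⟨-, -, h⟩
      rw [E₁.v5] at h
      rw [h]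
      split
      · rfl
      -- For k > n no digit is selected and the answer stays 0, which is the true count.
      · exact (cliquePartitionCount_eq_zero G k r hr (by omega)).symm
  · intro s F h
    refine Triple.assign ?_ ?_
    · rw [Expr.eval_var, h]
      have := hp k
      simp only [hpdef]
      omega
    · rw [Expr.eval_var, h]
      simp [hpdef]

/-- The fifth power comes from N rounds, N nodes and N candidate children, and from about (n + 1)^2
L steps per message, the square being the clique test for each listed set. -/
theorem Triple.main {L : ℕ} (hbag : D.bag root = ∅) (hr : 2 ≤ r) (hB : modulus n < 2 ^ B)
    (hL : ∀ x, 2 ^ (D.bag x).card ≤ L) :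
    Triple W B Program.main (inputState D root k r)
      (500 * (n + N + 1) ^ 5 * L) fun s => s.var 0 = cliquePartitionCount G k r := by
  obtain ⟨g, hg⟩ := exists_eq_combine D root r
  have hL1 : 1 ≤ L := le_trans Nat.one_le_two_pow (hL root)
  refine Triple.mono (T := 100 * (n + 1) +
    ((N * ((N * (200 * (N + 1) * ((n + 1) ^ 2 * L) + 4) + 3) + 4) + 3) + 20 * (n + 1) + 1) + 1)
    (Q := _) ?_ ?_ fun _ _ h => h
  · refine Triple.seq (Triple.setup hB) ?_
    rintro s₁ F₁ ⟨E₁, h₁⟩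
    refine Triple.seq (Triple.processTree E₁ hB.le hL (fun _ _ => 0) g
      (fun x M _ _ => by rw [h₁]; simp) hg) fun s₂ F₂ h₂ => ?_
    have E₂ := E₁.frame F₂ (by decide) (by decide)
    refine Triple.extract E₂ hr hB.le ?_
    have := h₂ root 0 (by positivity) (by simp [bits_zero])
    rw [add_zero, bits_zero, root_table hbag hr hg] at this
    exact this
  · set X := n + N + 1 with hX
    have hX1 : 1 ≤ X := by omega
    have a1 : n + 1 ≤ X := by omega
    have a2 : N + 1 ≤ X := by omega
    have a3 : N ≤ X := by omega
    have b1 : (N + 1) * ((n + 1) ^ 2 * L) ≤ X * (X ^ 2 * L) := by gcongr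
    have b2 : 1 ≤ X * (X ^ 2 * L) := Nat.mul_pos hX1 (by positivity)
    have b3 : N * (200 * (N + 1) * ((n + 1) ^ 2 * L) + 4) ≤ X * (204 * (X * (X ^ 2 * L))) :=
      Nat.mul_le_mul a3 (by nlinarith)
    have b4 : 1 ≤ X * (X * (X ^ 2 * L)) := Nat.mul_pos hX1 b2
    have b5 : N * ((N * (200 * (N + 1) * ((n + 1) ^ 2 * L) + 4) + 3) + 4) ≤
        X * (211 * (X * (X * (X ^ 2 * L)))) := Nat.mul_le_mul a3 (by nlinarith)
    have b6 : X * (X * (X * (X ^ 2 * L))) = X ^ 5 * L := by ring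
    have b7 : X ≤ X ^ 5 * L := by
      rw [← b6]
      exact Nat.le_mul_of_pos_right _ b4
    nlinarith

end Verification

end CliquePartition

/-! ### The running time in terms of the input length -/

theorem theorem4 :
    ∃ (P : CliquePartition.Program) (C c : ℕ),
      ∀ (n N : ℕ) (G : SimpleGraph (Fin n))
        (D : CliquePartition.TreeDecomposition G (Fin N)) (root : Fin N) (k r : ℕ),
        D.IsNice root → 2 ≤ r →
        ∃ (s : CliquePartition.State) (t : ℕ),
          CliquePartition.Exec P (CliquePartition.inputState D root k r) s t ∧
          s.var 0 = CliquePartition.cliquePartitionCount G k r ∧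
          t ≤ C * 2 ^ D.width * (n + N + Nat.size k + Nat.size r) ^ c := by
  -- The constant is 3 · 500 · 2: from B + 1 ≤ 3 X^4, from the step count, and from 2^(width + 1).
  -- The exponent is 4 for the length of the numbers plus 5 for the number of steps.
  refine ⟨CliquePartition.Program.main, 3000 * CliquePartition.Program.main.weight, 9, ?_⟩
  intro n N G D root k r hD hr
  set X := n + N + Nat.size k + Nat.size r with hX
  set B := (n + 1) ^ 4 + N + Nat.size k + Nat.size r with hB
  -- The length of r exceeds 1, which absorbs the additive constants and makes `modulus n` strictly
  -- smaller than 2^B.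
  have hr2 : 2 ≤ Nat.size r := by
    rw [← Nat.lt_iff_add_one_le, Nat.lt_size]
    exact hr
  have hnX : n + N + 1 ≤ X := by omega
  have hmB : CliquePartition.modulus n < 2 ^ B := by
    rw [CliquePartition.modulus_eq]
    exact Nat.pow_lt_pow_right (by norm_num) (by omega)
  have hpow : ∀ {a b : ℕ}, a < 2 ^ b → b ≤ B → a < 2 ^ B := fun h h' =>
    h.trans_le (Nat.pow_le_pow_right (by norm_num) h')
  have hn4 : n + 1 ≤ (n + 1) ^ 4 := Nat.le_self_pow (by norm_num) _
  have hb : CliquePartition.Bounded B (CliquePartition.inputState D root k r) := by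
    have h01 : 1 < 2 ^ B := Nat.one_lt_two_pow (by omega)
    have hmat : ∀ {a b : ℕ} (R : Fin a → Fin b → Prop) (i : ℕ),
        CliquePartition.matrixArray R i < 2 ^ B := by
      intro a b R i
      unfold CliquePartition.matrixArray
      split <;> omega
    constructor
    · intro x
      match x with
      | 0 => exact hpow (a := n) (b := n) Nat.lt_two_pow_self (by omega)
      | 1 => exact hpow (a := N) (b := N) Nat.lt_two_pow_self (by omega)
      | 2 => exact hpow (a := k) (Nat.lt_size_self k) (by omega)
      | 3 => exact hpow (a := r) (Nat.lt_size_self r) (by omega)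
      | 4 => exact hpow (a := root) (b := N) (root.2.trans Nat.lt_two_pow_self) (by omega)
      | _ + 5 => exact Nat.two_pow_pos B
    · intro a i
      match a with
      | 0 => exact hmat _ i
      | 1 => exact hmat _ i
      | 2 => exact hmat _ i
      | _ + 3 => exact Nat.two_pow_pos B
  -- A bag has at most width + 1 elements, also when the truncated subtraction makes the width 0.
  have hL : ∀ x, 2 ^ (D.bag x).card ≤ 2 * 2 ^ D.width := by
    intro x
    rw [← pow_succ']
    refine Nat.pow_le_pow_right (by norm_num) ?_
    have := Finset.le_sup (f := fun x => (D.bag x).card) (Finset.mem_univ x)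
    rw [CliquePartition.TreeDecomposition.width]
    omega
  obtain ⟨s, t, h1, h2, -, -, h3⟩ :=
    CliquePartition.Triple.main (k := k) hD.1 hr hmB hL hb le_rfl
  refine ⟨s, t, h1, h3, h2.trans ?_⟩
  have hB3 : B + 1 ≤ 3 * X ^ 4 := by
    have e1 : (n + 1) ^ 4 ≤ X ^ 4 := Nat.pow_le_pow_left (by omega) 4
    have e2 : X ≤ X ^ 4 := Nat.le_self_pow (by norm_num) _
    omega
  have hX5 : (n + N + 1) ^ 5 ≤ X ^ 5 := Nat.pow_le_pow_left hnX 5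
  calc CliquePartition.Program.main.weight * (B + 1) *
        (500 * (n + N + 1) ^ 5 * (2 * 2 ^ D.width))
      ≤ CliquePartition.Program.main.weight * (3 * X ^ 4) *
        (500 * X ^ 5 * (2 * 2 ^ D.width)) := by gcongr
    _ = 3000 * CliquePartition.Program.main.weight * 2 ^ D.width * X ^ 9 := by ring
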